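/- Consider the following imperative language of contracts (objects). An object has integer-valued fields, with different objects having different fields, and a single method with one parameter $\mathit{arg}$, integer-valued local variables, and a result variable $\mathit{ret}$. Method bodies are built from the primitive commands $x := e$, $F := x$, $x := F$, $\mathtt{assert}\ b$, $x := o(e)$ (call of the method of object $o$) and $\mathtt{skip}$ by sequential composition, conditionals and while loops, and every method ends with $\mathtt{return}$. Here $e$ and $b$ are integer and Boolean expressions over the local variables, and a method accesses only the fields of its own object. A context $\Gamma$ is a finite partial map from objects to their code. A state is a pair of a stack of frames (object, remaining code, values of local variables) and a store (a finite partial map from objects to the values of their fields); it is quiescent if its stack is empty, and active otherwise. In a quiescent state any object with code may be invoked with any natural number as its argument; apart from that the usual small-step semantics is deterministic, and a failed assertion or the use of an undefined value blocks. A complete execution in the context $\Gamma$ is a finite sequence of transitions of $\Gamma$ whose first and last states are quiescent and whose other states are active; a run is a concatenation of one or more complete executions in the same context. Executions and runs are well-formed if each transition starts in the state in which the preceding one ends. A run contains a callback to an object $o$ if the stack of one of its states contains two frames of $o$ with a frame of another object between them. A well-formed complete execution $\xi$ in a context $\Gamma$ is final-state effectively callback-free for $o$ ($\mathrm{DECF}^{o}_{FS}$)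 if there are a context $\Gamma'$ with $\Gamma'(o) = \Gamma(o)$ and a well-formed run $\xi'$ in $\Gamma'$, without callbacks to $o$, such that the first states of $\xi$ and $\xi'$ have the same store for $o$ and the last states of $\xi$ and $\xi'$ have the same store for $o$. **Theorem.** For every object $o$ the following problem is undecidable: given a well-formed complete execution $\xi$ together with its context $\Gamma$, is $\xi$ final-state effectively callback-free for $o$? The problem remains undecidable if only executions $\xi$ that contain a callback to $o$ are given. That is, under a standard Gödel numbering of finite inputs, no partial recursive function halts with the correct answer on all the inputs described. -/

import Mathlib

/-! # A while-language of contracts, callbacks, and final-state effective callback freedom -/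

namespace ECF

/-! ## Syntax -/

/-- Identifiers of contracts (= objects), of fields, and of local variables: three infinite supplies
of names. -/
abbrev ObjId : Type := ℕ
abbrev FieldId : Type := ℕ
abbrev VarId : Type := ℕ

/-- The formal parameter of every method. -/
def argVar : VarId := 0
/-- The variable in which a method leaves the value that it returns. -/
def retVar : VarId := 1
/-- The variable of the caller that receives the value returned by a callee. -/
def resVar : VarId := 2

/-- Integer expressions over local variables. -/
inductive Expr : Type
  | const (n : ℤ)
  | var (x : VarId)
  | add (e₁ e₂ : Expr)
  | sub (e₁ e₂ : Expr)
  | mul (e₁ e₂ : Expr)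

/-- Boolean expressions over local variables. -/
inductive BExpr : Type
  | eq (e₁ e₂ : Expr)
  | le (e₁ e₂ : Expr)
  | neg (b : BExpr)
  | conj (b₁ b₂ : BExpr)

/-- Commands that may occur in the body of a method. The command `return` that closes every method
is not part of the body; see `Frame`. -/
inductive Cmd : Type
  /-- `x := e` -/
  | assign (x : VarId) (e : Expr)
  /-- `F := x` -/
  | store (F : FieldId) (x : VarId)
  /-- `x := F` -/
  | load (x : VarId) (F : FieldId)
  /-- `assert b` -/
  | check (b : BExpr)
  /-- `x := o(e)`: call the method of the contract `o` -/
  | call (x : VarId) (o : ObjId) (e : Expr)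
  | skip
  | seq (C₁ C₂ : Cmd)
  | ifThenElse (b : BExpr) (C₁ C₂ : Cmd)
  | loop (b : BExpr) (C : Cmd)

/-! ## Semantic domains -/

/-- Finite partial maps on identifiers. -/
abbrev PMap (α : Type) : Type := Finmap (fun _ : ℕ => α)

/-- Local environments of invocations: finite partial maps from variables to integers. -/
abbrev Reg : Type := PMap ℤ

/-- States of one object: finite partial maps from fields to integers. -/
abbrev ObjState : Type := PMap ℤ

/-- Stores: finite partial maps from objects to object states. -/
abbrev Store : Type := PMap ObjState

/-- Code contexts: a finite partial map that gives the body `C` of the method `C ; return` of each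
contract. -/
abbrev Context : Type := PMap Cmd

/-- A stack frame: the object, the command that remains to be executed, the local environment.
The list `[C₁, …, Cₖ]` represents the remaining command `C₁ ; … ; Cₖ ; return`; in particular the
empty list represents `return`. -/
structure Frame : Type where
  obj : ObjId
  cmds : List Cmd
  env : Reg

/-- A state: a stack of frames, with the top (active) frame first, and a store. -/
structure State : Type where
  stack : List Frame
  store : Store

/-- A state is quiescent if its stack is empty, and active otherwise. -/
def State.Quiescent (s : State) : Prop := s.stack = []

/-- No two objects have a field with the same name. -/
def FieldsDisjoint (σ : Store) : Prop :=
  ∀ (o₁ o₂ : ObjId) (μ₁ μ₂ : ObjState), σ.lookup o₁ = some μ₁ → σ.lookup o₂ = some μ₂ → o₁ ≠ o₂ →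
    ∀ F : FieldId, F ∈ μ₁ → F ∉ μ₂

/-! ## Operational semantics -/

/-- Value of an expression; undefined if a variable without a value is read. -/
def Expr.eval (ρ : Reg) : Expr → Option ℤ
  | .const n => some n
  | .var x => ρ.lookup x
  | .add e₁ e₂ => do return (← e₁.eval ρ) + (← e₂.eval ρ)
  | .sub e₁ e₂ => do return (← e₁.eval ρ) - (← e₂.eval ρ)
  | .mul e₁ e₂ => do return (← e₁.eval ρ) * (← e₂.eval ρ)

/-- Value of a Boolean expression; undefined if a variable without a value is read. -/
def BExpr.eval (ρ : Reg) : BExpr → Option Bool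
  | .eq e₁ e₂ => do return decide ((← e₁.eval ρ) = (← e₂.eval ρ))
  | .le e₁ e₂ => do return decide ((← e₁.eval ρ) ≤ (← e₂.eval ρ))
  | .neg b => do return !(← b.eval ρ)
  | .conj b₁ b₂ => do return (← b₁.eval ρ) && (← b₂.eval ρ)

/-- The frame of a fresh invocation of `o` with body `C` and argument `n`. -/
def Frame.enter (o : ObjId) (C : Cmd) (n : ℤ) : Frame := ⟨o, [C], Finmap.singleton argVar n⟩

/-- The small-step transition relation in the code context `Γ`. In a quiescent state any object may
be invoked, with any natural number as its argument; in an active state at most one transition is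
possible. A command reads and writes only the environment of the top frame and the fields of the
active object. -/
inductive Step (Γ : Context) : State → State → Prop
  /-- an object is invoked from a quiescent state -/
  | invoke (σ : Store) (o : ObjId) (C : Cmd) (n : ℕ) (hC : Γ.lookup o = some C) (ho : o ∈ σ) :
      Step Γ ⟨[], σ⟩ ⟨[Frame.enter o C n], σ⟩
  /-- the outermost invocation returns -/
  | exit (σ : Store) (o : ObjId) (ρ : Reg) :
      Step Γ ⟨[⟨o, [], ρ⟩], σ⟩ ⟨[], σ⟩
  /-- the active method calls the method of `o'`; the rest of its code is `x := res ; K` -/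
  | call (σ : Store) (o o' : ObjId) (x : VarId) (e : Expr) (v : ℤ) (C : Cmd) (K : List Cmd)
      (ρ : Reg) (Θ : List Frame)
      (he : e.eval ρ = some v) (hC : Γ.lookup o' = some C) (ho : o' ∈ σ) :
      Step Γ ⟨⟨o, .call x o' e :: K, ρ⟩ :: Θ, σ⟩
        ⟨Frame.enter o' C v :: ⟨o, .assign x (.var resVar) :: K, ρ⟩ :: Θ, σ⟩
  /-- a called method returns the value of `ret` to its caller -/
  | ret (σ : Store) (o o' : ObjId) (v : ℤ) (K : List Cmd) (ρ ρ' : Reg) (Θ : List Frame)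
      (hv : ρ'.lookup retVar = some v) :
      Step Γ ⟨⟨o', [], ρ'⟩ :: ⟨o, K, ρ⟩ :: Θ, σ⟩ ⟨⟨o, K, ρ.insert resVar v⟩ :: Θ, σ⟩
  | assign (σ : Store) (o : ObjId) (x : VarId) (e : Expr) (v : ℤ) (K : List Cmd)
      (ρ : Reg) (Θ : List Frame) (he : e.eval ρ = some v) :
      Step Γ ⟨⟨o, .assign x e :: K, ρ⟩ :: Θ, σ⟩ ⟨⟨o, K, ρ.insert x v⟩ :: Θ, σ⟩
  | store (σ : Store) (o : ObjId) (F : FieldId) (x : VarId) (v : ℤ) (μ : ObjState) (K : List Cmd)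
      (ρ : Reg) (Θ : List Frame)
      (hx : ρ.lookup x = some v) (hμ : σ.lookup o = some μ) (hF : F ∈ μ) :
      Step Γ ⟨⟨o, .store F x :: K, ρ⟩ :: Θ, σ⟩ ⟨⟨o, K, ρ⟩ :: Θ, σ.insert o (μ.insert F v)⟩
  | load (σ : Store) (o : ObjId) (x : VarId) (F : FieldId) (v : ℤ) (μ : ObjState) (K : List Cmd)
      (ρ : Reg) (Θ : List Frame) (hμ : σ.lookup o = some μ) (hF : μ.lookup F = some v) :
      Step Γ ⟨⟨o, .load x F :: K, ρ⟩ :: Θ, σ⟩ ⟨⟨o, K, ρ.insert x v⟩ :: Θ, σ⟩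
  | check (σ : Store) (o : ObjId) (b : BExpr) (K : List Cmd) (ρ : Reg) (Θ : List Frame)
      (hb : b.eval ρ = some true) :
      Step Γ ⟨⟨o, .check b :: K, ρ⟩ :: Θ, σ⟩ ⟨⟨o, K, ρ⟩ :: Θ, σ⟩
  | skip (σ : Store) (o : ObjId) (K : List Cmd) (ρ : Reg) (Θ : List Frame) :
      Step Γ ⟨⟨o, .skip :: K, ρ⟩ :: Θ, σ⟩ ⟨⟨o, K, ρ⟩ :: Θ, σ⟩
  | seq (σ : Store) (o : ObjId) (C₁ C₂ : Cmd) (K : List Cmd) (ρ : Reg) (Θ : List Frame) :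
      Step Γ ⟨⟨o, .seq C₁ C₂ :: K, ρ⟩ :: Θ, σ⟩ ⟨⟨o, C₁ :: C₂ :: K, ρ⟩ :: Θ, σ⟩
  | ifTrue (σ : Store) (o : ObjId) (b : BExpr) (C₁ C₂ : Cmd) (K : List Cmd) (ρ : Reg)
      (Θ : List Frame) (hb : b.eval ρ = some true) :
      Step Γ ⟨⟨o, .ifThenElse b C₁ C₂ :: K, ρ⟩ :: Θ, σ⟩ ⟨⟨o, C₁ :: K, ρ⟩ :: Θ, σ⟩
  | ifFalse (σ : Store) (o : ObjId) (b : BExpr) (C₁ C₂ : Cmd) (K : List Cmd) (ρ : Reg)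
      (Θ : List Frame) (hb : b.eval ρ = some false) :
      Step Γ ⟨⟨o, .ifThenElse b C₁ C₂ :: K, ρ⟩ :: Θ, σ⟩ ⟨⟨o, C₂ :: K, ρ⟩ :: Θ, σ⟩
  | loopTrue (σ : Store) (o : ObjId) (b : BExpr) (C : Cmd) (K : List Cmd) (ρ : Reg)
      (Θ : List Frame) (hb : b.eval ρ = some true) :
      Step Γ ⟨⟨o, .loop b C :: K, ρ⟩ :: Θ, σ⟩ ⟨⟨o, C :: .loop b C :: K, ρ⟩ :: Θ, σ⟩
  | loopFalse (σ : Store) (o : ObjId) (b : BExpr) (C : Cmd) (K : List Cmd) (ρ : Reg)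
      (Θ : List Frame) (hb : b.eval ρ = some false) :
      Step Γ ⟨⟨o, .loop b C :: K, ρ⟩ :: Θ, σ⟩ ⟨⟨o, K, ρ⟩ :: Θ, σ⟩

/-! ## Executions and runs -/

/-- A pair of a source and a target state. -/
structure Transition : Type where
  src : State
  trg : State

/-- A finite sequence of transitions. -/
abbrev Execution : Type := List Transition

/-- Every member of the sequence is a transition in the context `Γ` between states in which
different objects have different fields. -/
def IsExecution (Γ : Context) (ξ : Execution) : Prop :=
  ∀ τ ∈ ξ, Step Γ τ.src τ.trg ∧ FieldsDisjoint τ.src.store ∧ FieldsDisjoint τ.trg.store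

/-- The target of each transition is the source of the next one. -/
def WellFormed (ξ : Execution) : Prop := ξ.IsChain (fun τ τ' => τ.trg = τ'.src)

/-- Complete executions: sequences `τ ξ' τ'` of transitions that start and end in quiescent states,
where `ξ'` contains only active states. -/
def IsComplete (Γ : Context) (ξ : Execution) : Prop :=
  IsExecution Γ ξ ∧ ∃ (τ : Transition) (ξ' : Execution) (τ' : Transition), ξ = τ :: (ξ' ++ [τ']) ∧
    τ.src.Quiescent ∧ τ'.trg.Quiescent ∧ ∀ t ∈ ξ', ¬ t.src.Quiescent ∧ ¬ t.trg.Quiescent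

/-- Runs: concatenations of one or more complete executions in the same context. -/
def IsRun (Γ : Context) (ξ : Execution) : Prop :=
  ∃ ξs : List Execution, ξs ≠ [] ∧ (∀ ζ ∈ ξs, IsComplete Γ ζ) ∧ ξ = ξs.flatten

/-- The first state of a non-empty execution. -/
def firstState (ξ : Execution) : Option State := ξ.head?.map Transition.src

/-- The last state of a non-empty execution. -/
def lastState (ξ : Execution) : Option State := ξ.getLast?.map Transition.trg

/-! ## Callbacks and effective callback freedom -/

/-- A stack contains a callback to `o` if a frame of `o` and another frame of `o` are separated by a
frame of a different object. -/
def StackCallback (o : ObjId) (Θ : List Frame) : Prop :=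
  ∃ c'' c' c : Frame, [c'', c', c].Sublist Θ ∧ c''.obj = o ∧ c'.obj ≠ o ∧ c.obj = o

/-- An execution contains a callback to `o` if the stack of one of its states does. -/
def HasCallback (o : ObjId) (ξ : Execution) : Prop :=
  ∃ τ ∈ ξ, StackCallback o τ.src.stack ∨ StackCallback o τ.trg.stack

/-- Object-final-state equivalence for `o` of two runs, each with its code context: the first states
have the same store for `o`, so have the last states, and the contexts have the same code for `o`. -/
def FinalStateEquiv (o : ObjId) (Γ₁ : Context) (ξ₁ : Execution) (Γ₂ : Context) (ξ₂ : Execution) :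
    Prop :=
  (firstState ξ₁).map (fun s => s.store.lookup o) =
      (firstState ξ₂).map (fun s => s.store.lookup o) ∧
    (lastState ξ₁).map (fun s => s.store.lookup o) =
      (lastState ξ₂).map (fun s => s.store.lookup o) ∧
    Γ₁.lookup o = Γ₂.lookup o

/-- The execution `ξ` in the context `Γ` is (dynamically, final-state) effectively callback-free for
`o`: some well-formed run without callbacks to `o`, in some context, is final-state equivalent to it
for `o`. -/
def DECF (o : ObjId) (Γ : Context) (ξ : Execution) : Prop :=
  ∃ (Γ' : Context) (ξ' : Execution), IsRun Γ' ξ' ∧ WellFormed ξ' ∧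
    FinalStateEquiv o Γ ξ Γ' ξ' ∧ ¬ HasCallback o ξ'

/-! ## Gödel numbering -/

def intCode : ℤ → ℕ
  | .ofNat n => 2 * n
  | .negSucc n => 2 * n + 1

def Expr.code : Expr → ℕ
  | .const n => Nat.pair 0 (intCode n)
  | .var x => Nat.pair 1 x
  | .add e₁ e₂ => Nat.pair 2 (Nat.pair e₁.code e₂.code)
  | .sub e₁ e₂ => Nat.pair 3 (Nat.pair e₁.code e₂.code)
  | .mul e₁ e₂ => Nat.pair 4 (Nat.pair e₁.code e₂.code)

def BExpr.code : BExpr → ℕ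
  | .eq e₁ e₂ => Nat.pair 0 (Nat.pair e₁.code e₂.code)
  | .le e₁ e₂ => Nat.pair 1 (Nat.pair e₁.code e₂.code)
  | .neg b => Nat.pair 2 b.code
  | .conj b₁ b₂ => Nat.pair 3 (Nat.pair b₁.code b₂.code)

def Cmd.code : Cmd → ℕ
  | .assign x e => Nat.pair 0 (Nat.pair x e.code)
  | .store F x => Nat.pair 1 (Nat.pair F x)
  | .load x F => Nat.pair 2 (Nat.pair x F)
  | .check b => Nat.pair 3 b.code
  | .call x o e => Nat.pair 4 (Nat.pair x (Nat.pair o e.code))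
  | .skip => Nat.pair 5 0
  | .seq C₁ C₂ => Nat.pair 6 (Nat.pair C₁.code C₂.code)
  | .ifThenElse b C₁ C₂ => Nat.pair 7 (Nat.pair b.code (Nat.pair C₁.code C₂.code))
  | .loop b C => Nat.pair 8 (Nat.pair b.code C.code)

/-- The number of a list, given a numbering of its members. -/
def listCode {α : Type} (c : α → ℕ) : List α → ℕ
  | [] => 0
  | a :: l => Nat.pair (c a) (listCode c l) + 1

/-- The number of a finite partial map: the number of the list of its key-value pairs, in increasing
order of the keys. -/
def pmapCode {α : Type} (c : α → ℕ) (m : PMap α) : ℕ :=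
  listCode (fun k => Nat.pair k ((m.lookup k).elim 0 c)) m.keys.sort

def Frame.code (f : Frame) : ℕ :=
  Nat.pair f.obj (Nat.pair (listCode Cmd.code f.cmds) (pmapCode intCode f.env))

def State.code (s : State) : ℕ :=
  Nat.pair (listCode Frame.code s.stack) (pmapCode (pmapCode intCode) s.store)

def Transition.code (τ : Transition) : ℕ := Nat.pair τ.src.code τ.trg.code

/-- The number of an execution together with its code context. -/
def inputCode (Γ : Context) (ξ : Execution) : ℕ :=
  Nat.pair (pmapCode Cmd.code Γ) (listCode Transition.code ξ)

/-! ### Distinct inputs have distinct numbers -/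

theorem intCode_injective : Function.Injective intCode := by
  rintro (a | a) (b | b) h <;> simp only [intCode] at h
  · have : a = b := by omega
    rw [this]
  · omega
  · omega
  · have : a = b := by omega
    rw [this]

theorem Expr.code_injective : Function.Injective Expr.code := by
  intro a
  induction a with
  | const n => intro b h; cases b <;> simp_all [Expr.code, Nat.pair_eq_pair, intCode_injective.eq_iff]
  | var x => intro b h; cases b <;> simp_all [Expr.code, Nat.pair_eq_pair]
  | add _ _ h₁ h₂ | sub _ _ h₁ h₂ | mul _ _ h₁ h₂ =>
    intro b h
    cases b <;> simp [Expr.code, Nat.pair_eq_pair] at h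
    rw [h₁ h.1, h₂ h.2]

theorem BExpr.code_injective : Function.Injective BExpr.code := by
  intro a
  induction a with
  | eq _ _ | le _ _ =>
    intro b h
    cases b <;> simp_all [BExpr.code, Nat.pair_eq_pair, Expr.code_injective.eq_iff]
  | neg _ h₁ =>
    intro b h
    cases b <;> simp [BExpr.code, Nat.pair_eq_pair] at h
    rw [h₁ h]
  | conj _ _ h₁ h₂ =>
    intro b h
    cases b <;> simp [BExpr.code, Nat.pair_eq_pair] at h
    rw [h₁ h.1, h₂ h.2]

theorem Cmd.code_injective : Function.Injective Cmd.code := by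
  intro a
  induction a with
  | assign _ _ | store _ _ | load _ _ | check _ | call _ _ _ | skip =>
    intro b h
    cases b <;> simp_all [Cmd.code, Nat.pair_eq_pair, Expr.code_injective.eq_iff,
      BExpr.code_injective.eq_iff]
  | seq _ _ h₁ h₂ =>
    intro b h
    cases b <;> simp [Cmd.code, Nat.pair_eq_pair] at h
    rw [h₁ h.1, h₂ h.2]
  | ifThenElse _ _ _ h₁ h₂ =>
    intro b h
    cases b <;> simp [Cmd.code, Nat.pair_eq_pair, BExpr.code_injective.eq_iff] at h
    rw [h.1, h₁ h.2.1, h₂ h.2.2]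
  | loop _ _ h₁ =>
    intro b h
    cases b <;> simp [Cmd.code, Nat.pair_eq_pair, BExpr.code_injective.eq_iff] at h
    rw [h.1, h₁ h.2]

theorem listCode_inj {α : Type} (c d : α → ℕ) :
    ∀ l l' : List α, listCode c l = listCode d l' → l.map c = l'.map d
  | [], [], _ => rfl
  | [], _ :: _, h => by simp [listCode] at h
  | _ :: _, [], h => by simp [listCode] at h
  | _ :: l, _ :: l', h => by
    simp only [listCode, Nat.add_right_cancel_iff, Nat.pair_eq_pair] at h
    simp [h.1, listCode_inj c d l l' h.2]

theorem listCode_injective {α : Type} {c : α → ℕ} (hc : Function.Injective c) :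
    Function.Injective (listCode c) :=
  fun l l' h => List.map_injective_iff.2 hc (listCode_inj c c l l' h)

theorem pmapCode_injective {α : Type} {c : α → ℕ} (hc : Function.Injective c) :
    Function.Injective (pmapCode c) := by
  intro m m' h
  have h₁ := listCode_inj _ _ _ _ h
  have hs : m.keys.sort = m'.keys.sort := by
    have := congrArg (List.map (fun n => (Nat.unpair n).1)) h₁
    simpa [List.map_map, Function.comp_def] using this
  have hk : m.keys = m'.keys := by
    rw [← Finset.sort_toFinset m.keys (· ≤ ·), ← Finset.sort_toFinset m'.keys (· ≤ ·), hs]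
  rw [hs] at h₁
  refine Finmap.ext_lookup fun k => ?_
  by_cases hm : k ∈ m'
  · have hm' : k ∈ m := by rw [← Finmap.mem_keys, hk]; exact Finmap.mem_keys.2 hm
    have h₂ := List.map_inj_left.1 h₁ k ((Finset.mem_sort _).2 (Finmap.mem_keys.2 hm))
    obtain ⟨v, hv⟩ := Finmap.mem_iff.1 hm
    obtain ⟨w, hw⟩ := Finmap.mem_iff.1 hm'
    simp only [hv, hw, Option.elim_some, Nat.pair_eq_pair, true_and] at h₂
    rw [hv, hw, hc h₂]
  · have hm' : k ∉ m := by rw [← Finmap.mem_keys, hk]; exact fun h => hm (Finmap.mem_keys.1 h)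
    rw [Finmap.lookup_eq_none.2 hm, Finmap.lookup_eq_none.2 hm']

theorem Frame.code_injective : Function.Injective Frame.code := by
  rintro ⟨o, K, ρ⟩ ⟨o', K', ρ'⟩ h
  simp only [Frame.code, Nat.pair_eq_pair] at h
  rw [h.1, listCode_injective Cmd.code_injective h.2.1, pmapCode_injective intCode_injective h.2.2]

theorem State.code_injective : Function.Injective State.code := by
  rintro ⟨Θ, σ⟩ ⟨Θ', σ'⟩ h
  simp only [State.code, Nat.pair_eq_pair] at h
  rw [listCode_injective Frame.code_injective h.1,
    pmapCode_injective (pmapCode_injective intCode_injective) h.2]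

theorem Transition.code_injective : Function.Injective Transition.code := by
  rintro ⟨s, t⟩ ⟨s', t'⟩ h
  simp only [Transition.code, Nat.pair_eq_pair] at h
  rw [State.code_injective h.1, State.code_injective h.2]

theorem inputCode_inj {Γ Γ' : Context} {ξ ξ' : Execution}
    (h : inputCode Γ ξ = inputCode Γ' ξ') : Γ = Γ' ∧ ξ = ξ' := by
  simp only [inputCode, Nat.pair_eq_pair] at h
  exact ⟨pmapCode_injective Cmd.code_injective h.1, listCode_injective Transition.code_injective h.2⟩

/-! ## Decision problems about executions -/

/-- The problem `P`, posed for the executions with property `V`, is decidable: some algorithm halts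
on the number of every execution with property `V` and answers whether the execution has property
`P`. Nothing is asked of the algorithm on other inputs. -/
def DecidableOn (V P : Context → Execution → Prop) : Prop :=
  ∃ f : ℕ →. Bool, Partrec f ∧
    ∀ Γ ξ, V Γ ξ → ∃ b ∈ f (inputCode Γ ξ), (b = true ↔ P Γ ξ)

end ECF

namespace ECF

/-! The halting problem is reduced to effective callback freedom. The object `o` has one field,
whose initial value `n` is the number of a program. Its method offers two ways of changing the field
from `n` to `-2`. With argument `0` it locks the field at `-1`, calls another object, and blocks
unless it then finds `-2`; only an invocation of `o` made while the first one waits can write this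
value, and that is a callback. With any other argument it runs a command `U` that terminates if and
only if program `n` halts on input `0`, and then writes `-2`.

The execution given as input takes the first way, so it can be computed from `n` whether or not the
program halts. If the program halts, the second way is a run with a single invocation and without
callbacks (`decf_of_terminates`). If it does not, no callback-free run in any context leads from `n`
to `-2` (`not_decf_of_diverges`): other objects cannot write the field of `o`, an invocation that
locks never returns without a callback, and an invocation that runs `U` never returns at all. This
is expressed by an invariant of single transitions (`Trapped.step`, `Invariant.step`) that uses the
code of `o` only.

Two further ingredients are needed. Every partial recursive function is computed by a command on
local variables that terminates exactly on the domain of the function (`exists_computes`). And the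
input is computable from `n` (`computable_callbackExecution`), because the context is fixed and the
executions for different `n` have the same shape and differ only in the numbers they contain. -/

/-! ## Pure commands and their big-step semantics -/

/-- Commands that access local variables only. -/
def Cmd.IsPure : Cmd → Prop
  | .assign _ _ => True
  | .skip => True
  | .seq C₁ C₂ => C₁.IsPure ∧ C₂.IsPure
  | .ifThenElse _ C₁ C₂ => C₁.IsPure ∧ C₂.IsPure
  | .loop _ C => C.IsPure
  | _ => False

/-- Big-step semantics of pure commands. -/
inductive BigStep : Cmd → Reg → Reg → Prop
  | assign {x e v ρ} (he : Expr.eval ρ e = some v) : BigStep (.assign x e) ρ (ρ.insert x v)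
  | skip {ρ} : BigStep .skip ρ ρ
  | seq {C₁ C₂ ρ ρ₁ ρ₂} (h₁ : BigStep C₁ ρ ρ₁) (h₂ : BigStep C₂ ρ₁ ρ₂) :
      BigStep (.seq C₁ C₂) ρ ρ₂
  | ifTrue {b C₁ C₂ ρ ρ₁} (hb : BExpr.eval ρ b = some true) (h : BigStep C₁ ρ ρ₁) :
      BigStep (.ifThenElse b C₁ C₂) ρ ρ₁
  | ifFalse {b C₁ C₂ ρ ρ₁} (hb : BExpr.eval ρ b = some false) (h : BigStep C₂ ρ ρ₁) :
      BigStep (.ifThenElse b C₁ C₂) ρ ρ₁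
  | loopTrue {b C ρ ρ₁ ρ₂} (hb : BExpr.eval ρ b = some true) (h₁ : BigStep C ρ ρ₁)
      (h₂ : BigStep (.loop b C) ρ₁ ρ₂) : BigStep (.loop b C) ρ ρ₂
  | loopFalse {b C ρ} (hb : BExpr.eval ρ b = some false) : BigStep (.loop b C) ρ ρ

/-- Started in `ρ`, the command `C` terminates if and only if `D` holds, and then `Q` holds of the
final environment. -/
def Spec (C : Cmd) (ρ : Reg) (D : Prop) (Q : Reg → Prop) : Prop :=
  (∀ ρ', BigStep C ρ ρ' → D ∧ Q ρ') ∧ (D → ∃ ρ', BigStep C ρ ρ')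

namespace Spec

variable {C C₁ C₂ : Cmd} {ρ : Reg} {D D₁ : Prop} {Q Q₁ : Reg → Prop} {b : BExpr}

theorem mono (h : Spec C ρ D Q₁) (hQ : ∀ ρ', Q₁ ρ' → Q ρ') : Spec C ρ D Q :=
  ⟨fun ρ' h' => ⟨(h.1 ρ' h').1, hQ _ (h.1 ρ' h').2⟩, h.2⟩

theorem assign {x : VarId} {e : Expr} {v : ℤ} (he : e.eval ρ = some v) (hD : D)
    (hQ : Q (ρ.insert x v)) : Spec (.assign x e) ρ D Q := by
  refine ⟨fun ρ' h => ?_, fun _ => ⟨_, .assign he⟩⟩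
  cases h with
  | assign he' =>
    rw [he] at he'
    cases he'
    exact ⟨hD, hQ⟩

theorem skip (hD : D) (hQ : Q ρ) : Spec .skip ρ D Q := by
  refine ⟨fun ρ' h => ?_, fun _ => ⟨_, .skip⟩⟩
  cases h
  exact ⟨hD, hQ⟩

/-- `D` is the domain of the whole sequence. It may be claimed for `C₂` alone, because `h₂` is used
only after `C₁` has terminated. -/
theorem seq (h₁ : Spec C₁ ρ D₁ Q₁) (hD : D → D₁)
    (h₂ : ∀ ρ₁, D₁ → Q₁ ρ₁ → Spec C₂ ρ₁ D Q) : Spec (.seq C₁ C₂) ρ D Q := by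
  refine ⟨fun ρ' h => ?_, fun d => ?_⟩
  · cases h with
    | seq a b => exact (h₂ _ (h₁.1 _ a).1 (h₁.1 _ a).2).1 _ b
  · obtain ⟨ρ₁, a⟩ := h₁.2 (hD d)
    obtain ⟨ρ₂, b⟩ := (h₂ _ (h₁.1 _ a).1 (h₁.1 _ a).2).2 d
    exact ⟨ρ₂, .seq a b⟩

theorem assign_seq {x : VarId} {e : Expr} {v : ℤ} (he : e.eval ρ = some v)
    (h : Spec C (ρ.insert x v) D Q) : Spec (.seq (.assign x e) C) ρ D Q :=
  seq (D₁ := True) (Q₁ := fun ρ' => ρ' = ρ.insert x v) (assign he trivial rfl) (fun _ => trivial)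
    (by rintro _ - rfl; exact h)

theorem ifTrue (hb : b.eval ρ = some true) (h : Spec C₁ ρ D Q) :
    Spec (.ifThenElse b C₁ C₂) ρ D Q := by
  refine ⟨fun ρ' h' => ?_, fun d => (h.2 d).imp fun _ => .ifTrue hb⟩
  cases h' with
  | ifTrue _ a => exact h.1 _ a
  | ifFalse hb' => simp [hb] at hb'

theorem ifFalse (hb : b.eval ρ = some false) (h : Spec C₂ ρ D Q) :
    Spec (.ifThenElse b C₁ C₂) ρ D Q := by
  refine ⟨fun ρ' h' => ?_, fun d => (h.2 d).imp fun _ => .ifFalse hb⟩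
  cases h' with
  | ifFalse _ a => exact h.1 _ a
  | ifTrue hb' => simp [hb] at hb'

/-- The rule for loops: `I i` holds after `i` iterations, and if the loop is to terminate then there
are at most `N` of them. -/
theorem loop {I : ℕ → Reg → Prop} (N : ℕ)
    (h : ∀ i ρ, I i ρ → (b.eval ρ = some false ∧ D ∧ Q ρ) ∨
      (b.eval ρ = some true ∧ ∃ D₁, Spec C ρ D₁ (I (i + 1)) ∧ (D → D₁ ∧ i < N)))
    (h₀ : I 0 ρ) : Spec (.loop b C) ρ D Q := by
  constructor
  · suffices ∀ L ρ ρ', BigStep L ρ ρ' → L = .loop b C → ∀ i, I i ρ → D ∧ Q ρ' from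
      fun ρ' h' => this _ _ _ h' rfl 0 h₀
    intro L ρ ρ' hL
    induction hL with
    | loopTrue hb h₁ _ _ ih =>
      intro e i hi
      cases e
      rcases h i _ hi with ⟨hb', -⟩ | ⟨-, D₁, hC, -⟩
      · simp [hb] at hb'
      · exact ih rfl (i + 1) (hC.1 _ h₁).2
    | loopFalse hb =>
      intro e i hi
      cases e
      rcases h i _ hi with ⟨-, hQ⟩ | ⟨hb', -⟩
      · exact hQ
      · simp [hb] at hb'
    | _ => intro e; cases e
  · intro d
    -- `j` bounds the number of iterations that are left.
    suffices ∀ j i ρ, I i ρ → N ≤ i + j → ∃ ρ', BigStep (.loop b C) ρ ρ' from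
      this N 0 ρ h₀ (by omega)
    intro j
    induction j with
    | zero =>
      intro i ρ hi hN
      rcases h i _ hi with ⟨hb, -⟩ | ⟨-, D₁, -, hD⟩
      · exact ⟨ρ, .loopFalse hb⟩
      · have := (hD d).2
        omega
    | succ j ih =>
      intro i ρ hi hN
      rcases h i _ hi with ⟨hb, -⟩ | ⟨hb, D₁, hC, hD⟩
      · exact ⟨ρ, .loopFalse hb⟩
      · obtain ⟨ρ₁, h₁⟩ := hC.2 (hD d).1
        obtain ⟨ρ₂, h₂⟩ := ih (i + 1) ρ₁ (hC.1 _ h₁).2 (by omega)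
        exact ⟨ρ₂, .loopTrue hb h₁ h₂⟩

end Spec

/-! ## Pairing and unpairing -/

/-- `z := pair x y` -/
def pairCmd (x y z : VarId) : Cmd :=
  .ifThenElse (.le (.var y) (.var x))
    (.assign z (.add (.add (.mul (.var x) (.var x)) (.var x)) (.var y)))
    (.assign z (.add (.mul (.var y) (.var y)) (.var x)))

theorem spec_pairCmd {x y z : ℕ} {ρ : Reg} {m n : ℕ} {D : Prop} {Q : Reg → Prop} (hD : D)
    (hx : ρ.lookup x = some (m : ℤ)) (hy : ρ.lookup y = some (n : ℤ))
    (hQ : Q (ρ.insert z (Nat.pair m n : ℤ))) : Spec (pairCmd x y z) ρ D Q := by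
  by_cases h : n ≤ m
  · refine .ifTrue (by simp [BExpr.eval, Expr.eval, hx, hy, h]) (.assign ?_ hD hQ)
    simp [Expr.eval, hx, hy, Nat.pair, Nat.not_lt.2 h]
  · refine .ifFalse (by simpa [BExpr.eval, Expr.eval, hx, hy] using h) (.assign ?_ hD hQ)
    simp [Expr.eval, hx, hy, Nat.pair, Nat.not_le.1 h]

/-- `y := sqrt x` -/
def sqrtCmd (x y : VarId) : Cmd :=
  .seq (.assign y (.const 0))
    (.loop (.le (.mul (.add (.var y) (.const 1)) (.add (.var y) (.const 1))) (.var x))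
      (.assign y (.add (.var y) (.const 1))))

/-- `(y, z) := unpair x` -/
def unpairCmd (x y z : VarId) : Cmd :=
  .seq (sqrtCmd x z) (.seq (.assign y (.sub (.var x) (.mul (.var z) (.var z))))
    (.ifThenElse (.le (.var z) (.var y))
      (.seq (.assign z (.sub (.var y) (.var z))) (.assign y (.sub (.var y) (.var z)))) .skip))

theorem spec_sqrtCmd {x y : ℕ} {ρ : Reg} {n : ℕ} (hx : ρ.lookup x = some (n : ℤ))
    (hxy : x ≠ y) :
    Spec (sqrtCmd x y) ρ True (fun ρ' => ρ'.lookup y = some (n.sqrt : ℤ) ∧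
      ∀ i : ℕ, i ≠ y → ρ'.lookup i = ρ.lookup i) := by
  -- After `i` iterations `y = i`. Another iteration requires `(i + 1) * (i + 1) ≤ n`, hence `i <
  -- n`, so `n` bounds their number.
  refine .assign_seq rfl (.loop (I := fun i ρ' => ρ'.lookup y = some (i : ℤ) ∧ i * i ≤ n ∧
    ∀ i : ℕ, i ≠ y → ρ'.lookup i = ρ.lookup i) n ?_ ?_)
  · rintro i ρ' ⟨hy, hi, hρ⟩
    have hx' : ρ'.lookup x = some (n : ℤ) := by rw [hρ x hxy, hx]
    by_cases h : (i + 1) * (i + 1) ≤ n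
    · refine .inr ⟨?_, True, .assign (v := (i : ℤ) + 1) ?_ trivial ?_, fun _ => ⟨trivial, ?_⟩⟩
      · simp only [BExpr.eval, Expr.eval, hy, hx', Option.pure_def, Option.bind_eq_bind,
          Option.bind_some, Option.some.injEq, decide_eq_true_eq]
        exact_mod_cast h
      · simp [Expr.eval, hy]
      · refine ⟨by simp, h, fun j hj => ?_⟩
        rw [Finmap.lookup_insert_of_ne _ hj, hρ j hj]
      · nlinarith
    · refine .inl ⟨?_, trivial, ?_, hρ⟩
      · simp only [BExpr.eval, Expr.eval, hy, hx', Option.pure_def, Option.bind_eq_bind,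
          Option.bind_some, Option.some.injEq, decide_eq_false_iff_not]
        exact_mod_cast h
      · rw [hy, Nat.eq_sqrt.2 ⟨hi, Nat.not_le.1 h⟩]
  · refine ⟨by simp, by simp, fun i hi => Finmap.lookup_insert_of_ne _ hi⟩

theorem spec_unpairCmd {x y z : ℕ} {ρ : Reg} {n : ℕ} (hx : ρ.lookup x = some (n : ℤ))
    (hxz : x ≠ z) (hyz : y ≠ z) :
    Spec (unpairCmd x y z) ρ True (fun ρ' => ρ'.lookup y = some (n.unpair.1 : ℤ) ∧
      ρ'.lookup z = some (n.unpair.2 : ℤ) ∧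
      ∀ i : ℕ, i ≠ y → i ≠ z → ρ'.lookup i = ρ.lookup i) := by
  refine .seq (spec_sqrtCmd hx hxz) id ?_
  rintro ρ₁ - ⟨hz, hρ⟩
  have hx' : ρ₁.lookup x = some (n : ℤ) := by rw [hρ x hxz, hx]
  have hs := Nat.sqrt_le n
  refine .assign_seq (v := ((n - n.sqrt * n.sqrt : ℕ) : ℤ)) ?_ ?_
  · simp [Expr.eval, hx', hz, Nat.cast_sub hs]
  by_cases h : n.sqrt ≤ n - n.sqrt * n.sqrt
  -- With `s` the root and `r = n - s * s`, the pair `(r, s)` in `(y, z)` becomes `(s, r - s)`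
  -- without an auxiliary variable: the second assignment computes `r - (r - s)`.
  · refine .ifTrue (by simpa [BExpr.eval, Expr.eval, hz, hyz.symm] using h)
      (.assign_seq (v := ((n - n.sqrt * n.sqrt - n.sqrt : ℕ) : ℤ)) ?_
        (.assign (v := (n.sqrt : ℤ)) ?_ trivial ?_))
    · simp [Expr.eval, hz, hyz.symm, Nat.cast_sub h]
    · simp [Expr.eval, hyz, Nat.cast_sub h]
    · rw [Nat.unpair, if_neg (Nat.not_lt.2 h)]
      refine ⟨by simp, by simp [hyz.symm], fun i hy hz => ?_⟩
      simp [hy, hz, hρ]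
  · refine .ifFalse (by simpa [BExpr.eval, Expr.eval, hz, hyz.symm] using h) (.skip trivial ?_)
    rw [Nat.unpair, if_pos (Nat.not_le.1 h)]
    refine ⟨by simp, by simp [hyz.symm, hz], fun i hy hz => ?_⟩
    simp [hy, hz, hρ]

theorem isPure_pairCmd (x y z : VarId) : (pairCmd x y z).IsPure := by simp [pairCmd, Cmd.IsPure]

theorem isPure_unpairCmd (x y z : VarId) : (unpairCmd x y z).IsPure := by
  simp [unpairCmd, sqrtCmd, Cmd.IsPure]

/-! ## Compilation of partial recursive functions -/

/-- `P k` computes `f` on the variable `k`, in place; it does not change variables below `k`. -/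
def Computes (P : ℕ → Cmd) (f : ℕ →. ℕ) : Prop :=
  ∀ k : ℕ, (P k).IsPure ∧ ∀ ρ n, ρ.lookup k = some ((n : ℕ) : ℤ) → Spec (P k) ρ (f n).Dom
    (fun ρ' => (∃ m ∈ f n, ρ'.lookup k = some (m : ℤ)) ∧ ∀ i : ℕ, i < k → ρ'.lookup i = ρ.lookup i)

/-- Induction on the construction of `f`. Since a program at `k` leaves the variables below `k`
alone, values that must survive a subprogram are kept in the variables from `k` on, and the
subprogram runs at a larger index. -/
theorem exists_computes {f : ℕ →. ℕ} (hf : Nat.Partrec f) : ∃ P, Computes P f := by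
  induction hf with
  | zero =>
    refine ⟨fun k => .assign k (.const 0), fun k => ⟨trivial, fun ρ n h => .assign rfl trivial ?_⟩⟩
    exact ⟨⟨0, by simp [pure, PFun.pure], by simp⟩,
      fun i hi => Finmap.lookup_insert_of_ne _ hi.ne⟩
  | succ =>
    refine ⟨fun k => .assign k (.add (.var k) (.const 1)), fun k => ⟨trivial, fun ρ n h =>
      .assign (v := (n : ℤ) + 1) (by simp [Expr.eval, h]) trivial ?_⟩⟩
    exact ⟨⟨n + 1, by simp, by simp⟩, fun i hi => Finmap.lookup_insert_of_ne _ hi.ne⟩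
  | left =>
    refine ⟨fun k : ℕ => .seq (unpairCmd k (k + 1) (k + 2)) (.assign k (.var (k + 1))), fun k =>
      ⟨⟨isPure_unpairCmd _ _ _, trivial⟩, fun ρ n h =>
        .seq (spec_unpairCmd h (by omega) (by omega)) (fun _ => trivial) ?_⟩⟩
    rintro ρ₁ - ⟨h₁, -, h₃⟩
    refine .assign h₁ trivial ⟨⟨_, Part.mem_some _, by simp⟩, fun i hi => ?_⟩
    rw [Finmap.lookup_insert_of_ne _ hi.ne, h₃ i (by omega) (by omega)]
  | right =>
    refine ⟨fun k : ℕ => .seq (unpairCmd k (k + 1) (k + 2)) (.assign k (.var (k + 2))), fun k =>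
      ⟨⟨isPure_unpairCmd _ _ _, trivial⟩, fun ρ n h =>
        .seq (spec_unpairCmd h (by omega) (by omega)) (fun _ => trivial) ?_⟩⟩
    rintro ρ₁ - ⟨-, h₂, h₃⟩
    refine .assign h₂ trivial ⟨⟨_, Part.mem_some _, by simp⟩, fun i hi => ?_⟩
    rw [Finmap.lookup_insert_of_ne _ hi.ne, h₃ i (by omega) (by omega)]
  | @pair f g _ _ ihf ihg =>
    obtain ⟨P, hP⟩ := ihf
    obtain ⟨R, hR⟩ := ihg
    refine ⟨fun k : ℕ => .seq (.assign (k + 1) (.var k)) (.seq (P (k + 1))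
      (.seq (.assign (k + 2) (.var k)) (.seq (R (k + 2)) (pairCmd (k + 1) (k + 2) k)))),
      fun k => ⟨⟨trivial, (hP _).1, trivial, (hR _).1, isPure_pairCmd _ _ _⟩, fun ρ n h =>
        .assign_seq h (.seq ((hP (k + 1)).2 _ n (by simp)) ?_ ?_)⟩⟩
    · intro d
      simp only [Seq.seq, Part.bind_dom, Part.map_eq_map, Part.map_Dom] at d
      exact d.1
    rintro ρ₁ df ⟨⟨a, ha, h₁⟩, hρ₁⟩
    have hk : ρ₁.lookup k = some (n : ℤ) := by rw [hρ₁ k (by omega)]; simp [h]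
    refine .assign_seq hk (.seq ((hR (k + 2)).2 _ n (by simp)) ?_ ?_)
    · intro d
      simp only [Seq.seq, Part.bind_dom, Part.map_eq_map, Part.map_Dom] at d
      exact d.2
    rintro ρ₂ dg ⟨⟨b, hb, h₂⟩, hρ₂⟩
    have hm : Nat.pair a b ∈ (Nat.pair <$> f n <*> g n) := by
      simp only [Seq.seq, Part.map_eq_map, Part.mem_bind_iff, Part.mem_map_iff]
      exact ⟨_, ⟨a, ha, rfl⟩, b, hb, rfl⟩
    refine spec_pairCmd (Part.dom_iff_mem.2 ⟨_, hm⟩) (m := a) (n := b) ?_ h₂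
      ⟨⟨_, hm, by simp⟩, fun i hi => ?_⟩
    · rw [hρ₂ (k + 1) (by omega), Finmap.lookup_insert_of_ne _ (by omega), h₁]
    · rw [Finmap.lookup_insert_of_ne _ hi.ne, hρ₂ i (by omega),
        Finmap.lookup_insert_of_ne _ (by omega), hρ₁ i (by omega),
        Finmap.lookup_insert_of_ne _ (by omega)]
  | @comp f g _ _ ihf ihg =>
    obtain ⟨P, hP⟩ := ihf
    obtain ⟨R, hR⟩ := ihg
    refine ⟨fun k : ℕ => .seq (R k) (P k), fun k => ⟨⟨(hR _).1, (hP _).1⟩, fun ρ n h =>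
      .seq ((hR k).2 _ n h) (fun d => (Part.bind_dom.1 d).1) ?_⟩⟩
    rintro ρ₁ dg ⟨⟨a, ha, h₁⟩, hρ₁⟩
    change Spec _ _ ((g n).bind f).Dom (fun ρ' => (∃ m ∈ (g n).bind f, _) ∧ _)
    have e : (g n).bind f = f a := by rw [Part.eq_some_iff.2 ha]; exact Part.bind_some _ _
    rw [e]
    refine ((hP k).2 _ a h₁).mono fun ρ₂ h₂ => ⟨h₂.1, fun i hi => ?_⟩
    rw [h₂.2 i hi, hρ₁ i hi]
  | @prec f g _ _ ihf ihg =>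
    obtain ⟨P, hP⟩ := ihf
    obtain ⟨R, hR⟩ := ihg
    -- Variable `k + 1` holds the parameter, `k + 2` the number of iterations, `k + 3` the current
    -- value and `k + 4` the counter; the step function runs at `k + 5`.
    refine ⟨fun k : ℕ => .seq (unpairCmd k (k + 1) (k + 2)) (.seq (.assign (k + 3) (.var (k + 1)))
      (.seq (P (k + 3)) (.seq (.assign (k + 4) (.const 0)) (.seq
        (.loop (.neg (.le (.var (k + 2)) (.var (k + 4))))
          (.seq (pairCmd (k + 4) (k + 3) (k + 5)) (.seq (pairCmd (k + 1) (k + 5) (k + 5))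
            (.seq (R (k + 5)) (.seq (.assign (k + 3) (.var (k + 5)))
              (.assign (k + 4) (.add (.var (k + 4)) (.const 1))))))))
        (.assign k (.var (k + 3))))))),
      fun k => ⟨?_, fun ρ n h =>
        .seq (spec_unpairCmd h (by omega) (by omega)) (fun _ => trivial) ?_⟩⟩
    · simp [Cmd.IsPure, isPure_unpairCmd, isPure_pairCmd, (hP _).1, (hR _).1]
    rintro ρ₁ - ⟨h₁, h₂, h₃⟩
    simp only [Nat.unpaired]
    generalize n.unpair.1 = a at *
    generalize n.unpair.2 = N at *
    set F : ℕ → Part ℕ := fun j => Nat.rec (f a)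
      (fun y IH => do let i ← IH; g (Nat.pair a (Nat.pair y i))) j with hF
    have hF0 : F 0 = f a := rfl
    have hFs : ∀ j, F (j + 1) = (F j).bind fun i => g (Nat.pair a (Nat.pair j i)) := fun j => rfl
    -- If the recursion is defined at some stage, it is defined at all earlier ones; hence every
    -- iteration terminates if the result exists.
    have hdom : ∀ i j, (F (i + j)).Dom → (F i).Dom := by
      intro i j
      induction j with
      | zero => exact id
      | succ j ih => exact fun d => ih (by rw [← Nat.add_assoc, hFs] at d; exact (Part.bind_dom.1 d).1)
    have hdom' : ∀ i, i ≤ N → (F N).Dom → (F i).Dom := fun i hi d =>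
      hdom i (N - i) (by rwa [Nat.add_sub_cancel' hi])
    change Spec _ _ (F N).Dom (fun ρ' => (∃ m ∈ F N, _) ∧ _)
    clear_value F
    refine .assign_seq h₁ (.seq ((hP (k + 3)).2 _ a (by simp)) (fun d => ?_) ?_)
    · exact hF0 ▸ hdom' 0 (Nat.zero_le _) d
    rintro ρ₂ - ⟨⟨r, hr, h₄⟩, h₅⟩
    refine .assign_seq rfl (.seq (D₁ := (F N).Dom) (Q₁ := fun ρ' => (∃ m ∈ F N,
      ρ'.lookup (k + 3) = some (m : ℤ)) ∧ ∀ i : ℕ, i < k → ρ'.lookup i = ρ.lookup i)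
      (.loop (I := fun j ρ' => j ≤ N ∧ ρ'.lookup (k + 1) = some (a : ℤ) ∧
        ρ'.lookup (k + 2) = some (N : ℤ) ∧ (∃ m ∈ F j, ρ'.lookup (k + 3) = some (m : ℤ)) ∧
        ρ'.lookup (k + 4) = some (j : ℤ) ∧ ∀ i : ℕ, i < k → ρ'.lookup i = ρ.lookup i) N ?_ ?_) id ?_)
    · rintro j ρ' ⟨hj, g₁, g₂, ⟨m, hm, g₃⟩, g₄, g₅⟩
      rcases hj.eq_or_lt with rfl | hj
      · refine .inl ⟨?_, Part.dom_iff_mem.2 ⟨m, hm⟩, ⟨m, hm, g₃⟩, g₅⟩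
        simp [BExpr.eval, Expr.eval, g₂, g₄]
      refine .inr ⟨?_, (F (j + 1)).Dom, ?_, fun d => ⟨hdom' _ hj d, hj⟩⟩
      · simp [BExpr.eval, Expr.eval, g₂, g₄, hj]
      have e : F (j + 1) = g (Nat.pair a (Nat.pair j m)) := by
        rw [hFs, Part.eq_some_iff.2 hm, Part.bind_some]
      refine .seq (D₁ := True) (Q₁ := fun ρ₁ => ρ₁ = _) (spec_pairCmd trivial g₄ g₃ rfl)
        (fun _ => trivial) ?_
      rintro _ - rfl
      refine .seq (D₁ := True) (Q₁ := fun ρ₁ => ρ₁ = _) (spec_pairCmd trivial (m := a)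
        (n := Nat.pair j m) ?_ (by simp) rfl) (fun _ => trivial) ?_
      · simp [g₁]
      rintro _ - rfl
      refine .seq ((hR (k + 5)).2 _ (Nat.pair a (Nat.pair j m)) (by simp)) (fun d => e ▸ d) ?_
      rintro ρ₃ d ⟨⟨s, hs, g₆⟩, g₇⟩
      have g₇' : ∀ i : ℕ, i < k + 5 → ρ₃.lookup i = ρ'.lookup i := by
        intro i hi
        rw [g₇ i hi, Finmap.lookup_insert_of_ne _ (by omega),
          Finmap.lookup_insert_of_ne _ (by omega)]
      refine .assign_seq g₆ (.assign (v := (j : ℤ) + 1) ?_ (by rwa [e])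
        ⟨hj, ?_, ?_, ⟨s, by rwa [e], ?_⟩, by simp, fun i hi => ?_⟩)
      · simp [Expr.eval, g₇', g₄]
      · simp [g₇', g₁]
      · simp [g₇', g₂]
      · simp
      · rw [Finmap.lookup_insert_of_ne _ (by omega), Finmap.lookup_insert_of_ne _ (by omega),
          g₇' i (by omega), g₅ i hi]
    · refine ⟨Nat.zero_le _, ?_, ?_, ⟨r, by rwa [hF0], ?_⟩, by simp, fun i hi => ?_⟩
      · simp [h₅, h₁]
      · simp [h₅, h₂]
      · simp [h₄]
      · rw [Finmap.lookup_insert_of_ne _ (by omega), h₅ i (by omega),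
          Finmap.lookup_insert_of_ne _ (by omega), h₃ i (by omega) (by omega)]
    · rintro ρ₃ d ⟨⟨m, hm, g₁⟩, g₂⟩
      refine .assign g₁ d ⟨⟨m, hm, by simp⟩, fun i hi => ?_⟩
      rw [Finmap.lookup_insert_of_ne _ (by omega), g₂ i hi]
  | @rfind f _ ih =>
    obtain ⟨P, hP⟩ := ih
    have hmem : ∀ a N, N ∈ (Nat.rfind fun n => (fun m => decide (m = 0)) <$> f (Nat.pair a n)) ↔
        0 ∈ f (Nat.pair a N) ∧ ∀ i < N, ∃ m ∈ f (Nat.pair a i), m ≠ 0 := by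
      intro a N
      refine Nat.mem_rfind.trans ?_
      simp [Part.map_eq_map]
    -- One evaluation of `f` at the candidate `j`. It occurs before the loop and again in its body.
    have key : ∀ (k : ℕ) ρ (a j : ℕ), ρ.lookup k = some (a : ℤ) → ρ.lookup (k + 1) = some (j : ℤ) →
        Spec (.seq (pairCmd k (k + 1) (k + 2)) (P (k + 2))) ρ (f (Nat.pair a j)).Dom (fun ρ' =>
          (∃ m ∈ f (Nat.pair a j), ρ'.lookup (k + 2) = some (m : ℤ)) ∧
            ∀ i : ℕ, i < k + 2 → ρ'.lookup i = ρ.lookup i) := by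
      intro k ρ a j h₁ h₂
      refine .seq (D₁ := True) (Q₁ := fun ρ₁ => ρ₁ = _) (spec_pairCmd trivial h₁ h₂ rfl)
        (fun _ => trivial) ?_
      rintro _ - rfl
      refine ((hP (k + 2)).2 _ (Nat.pair a j) (by simp)).mono
        fun ρ' h => ⟨h.1, fun i hi => ?_⟩
      rw [h.2 i hi, Finmap.lookup_insert_of_ne _ (by omega)]
    refine ⟨fun k : ℕ => .seq (.assign (k + 1) (.const 0)) (.seq
      (.seq (pairCmd k (k + 1) (k + 2)) (P (k + 2))) (.seq
        (.loop (.neg (.eq (.var (k + 2)) (.const 0)))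
          (.seq (.assign (k + 1) (.add (.var (k + 1)) (.const 1)))
            (.seq (pairCmd k (k + 1) (k + 2)) (P (k + 2)))))
        (.assign k (.var (k + 1))))),
      fun k => ⟨?_, fun ρ a h => .assign_seq rfl (.seq (key k _ a 0 (by simp [h]) (by simp)) ?_ ?_)⟩⟩
    · simp [Cmd.IsPure, isPure_pairCmd, (hP _).1]
    · intro d
      obtain ⟨N, hN⟩ := Part.dom_iff_mem.1 d
      obtain ⟨h₀, h₁⟩ := (hmem a N).1 hN
      rcases Nat.eq_zero_or_pos N with rfl | hN'
      · exact Part.dom_iff_mem.2 ⟨_, h₀⟩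
      · exact Part.dom_iff_mem.2 ((h₁ 0 hN').imp fun _ h => h.1)
    rintro ρ₁ - ⟨⟨r, hr, h₁⟩, h₂⟩
    replace hmem := hmem a
    beta_reduce
    generalize (Nat.rfind fun n => (fun m => decide (m = 0)) <$> f (Nat.pair a n)) = G at *
    refine .seq (D₁ := G.Dom) (Q₁ := fun ρ' => (∃ m ∈ G, ρ'.lookup (k + 1) = some (m : ℤ)) ∧
      ∀ i : ℕ, i < k → ρ'.lookup i = ρ.lookup i) (.loop (I := fun j ρ' => ρ'.lookup k = some (a : ℤ) ∧
        ρ'.lookup (k + 1) = some (j : ℤ) ∧ (∃ m ∈ f (Nat.pair a j),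
          ρ'.lookup (k + 2) = some (m : ℤ)) ∧ (∀ i < j, ∃ m ∈ f (Nat.pair a i), m ≠ 0) ∧
        -- The search makes as many iterations as its result says. The default `0` is harmless, as
        -- the bound matters only if `G` is defined.
        ∀ i : ℕ, i < k → ρ'.lookup i = ρ.lookup i) (by classical exact if d : G.Dom then G.get d else 0)
        ?_ ?_) id ?_
    · rintro j ρ' ⟨g₁, g₂, ⟨m, hm, g₃⟩, g₄, g₅⟩
      by_cases hm0 : m = 0
      · subst hm0
        have hj : j ∈ G := (hmem j).2 ⟨hm, g₄⟩
        exact .inl ⟨by simp [BExpr.eval, Expr.eval, g₃], Part.dom_iff_mem.2 ⟨j, hj⟩, ⟨j, hj, g₂⟩, g₅⟩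
      have hlt : ∀ i < j + 1, ∃ m ∈ f (Nat.pair a i), m ≠ 0 := by
        intro i hi
        rcases Nat.lt_succ_iff_lt_or_eq.1 hi with hi | rfl
        exacts [g₄ i hi, ⟨m, hm, hm0⟩]
      refine .inr ⟨by simp [BExpr.eval, Expr.eval, g₃, hm0], (f (Nat.pair a (j + 1))).Dom, ?_,
        fun d => ?_⟩
      · refine .assign_seq (v := (j : ℤ) + 1) (by simp [Expr.eval, g₂])
          ((key k _ a (j + 1) (by simp [g₁]) (by simp)).mono fun ρ₂ h => ⟨?_, ?_, h.1, hlt, ?_⟩)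
        · rw [h.2 _ (by omega)]; simp [g₁]
        · rw [h.2 _ (by omega)]; simp
        · intro i hi
          rw [h.2 _ (by omega), Finmap.lookup_insert_of_ne _ (by omega), g₅ i hi]
      · have hN := (hmem _).1 (Part.get_mem d)
        -- No value up to `j` is zero, so the least zero lies beyond `j`; the value at `j + 1` is
        -- then defined, being either an earlier nonzero value or the zero itself.
        have hjN : j < G.get d := by
          rcases Nat.lt_trichotomy j (G.get d) with h | h | h
          · exact h
          · rw [← h] at hN
            exact absurd (Part.mem_unique hm hN.1) hm0
          · obtain ⟨m', hm', hne⟩ := g₄ _ h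
            exact absurd (Part.mem_unique hm' hN.1) hne
        refine ⟨?_, by simpa [d] using hjN⟩
        rcases Nat.lt_or_eq_of_le (Nat.succ_le_of_lt hjN) with h | h
        · obtain ⟨m', hm', -⟩ := hN.2 _ h
          exact Part.dom_iff_mem.2 ⟨m', hm'⟩
        · exact Part.dom_iff_mem.2 ⟨0, by simpa [← h] using hN.1⟩
    · refine ⟨?_, ?_, ⟨r, hr, h₁⟩, by simp, fun i hi => ?_⟩
      · rw [h₂ _ (by omega)]; simp [h]
      · rw [h₂ _ (by omega)]; simp
      · rw [h₂ _ (by omega), Finmap.lookup_insert_of_ne _ (by omega)]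
    · rintro ρ₂ d ⟨⟨m, hm, g₁⟩, g₂⟩
      refine .assign g₁ d ⟨⟨m, hm, by simp⟩, fun i hi => ?_⟩
      rw [Finmap.lookup_insert_of_ne _ (by omega), g₂ i hi]

/-! ## Big steps and small steps -/

/-- A transition inside a frame that neither depends on the rest of the state nor changes it. -/
def LocalStep (a b : List Cmd × Reg) : Prop :=
  ∀ Γ o Θ σ, Step Γ ⟨⟨o, a.1, a.2⟩ :: Θ, σ⟩ ⟨⟨o, b.1, b.2⟩ :: Θ, σ⟩

theorem BigStep.localSteps {C : Cmd} {ρ ρ' : Reg} (h : BigStep C ρ ρ') :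
    ∀ K, Relation.ReflTransGen LocalStep (C :: K, ρ) (K, ρ') := by
  induction h with
  | assign he => exact fun K => .single fun Γ o Θ σ => .assign σ o _ _ _ K _ Θ he
  | skip => exact fun K => .single fun Γ o Θ σ => .skip σ o K _ Θ
  | seq _ _ ih₁ ih₂ =>
    exact fun K => .head (fun Γ o Θ σ => .seq σ o _ _ K _ Θ) ((ih₁ _).trans (ih₂ K))
  | ifTrue hb _ ih =>
    exact fun K => .head (fun Γ o Θ σ => .ifTrue σ o _ _ _ K _ Θ hb) (ih K)
  | ifFalse hb _ ih =>
    exact fun K => .head (fun Γ o Θ σ => .ifFalse σ o _ _ _ K _ Θ hb) (ih K)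
  | loopTrue hb _ _ ih₁ ih₂ =>
    exact fun K => .head (fun Γ o Θ σ => .loopTrue σ o _ _ K _ Θ hb) ((ih₁ _).trans (ih₂ K))
  | loopFalse hb => exact fun K => .single fun Γ o Θ σ => .loopFalse σ o _ _ K _ Θ hb

/-- Big-step semantics of a list of pure commands. -/
def BigSteps : List Cmd → Reg → Reg → Prop
  | [], ρ, ρ' => ρ = ρ'
  | C :: K, ρ, ρ' => ∃ ρ₁, BigStep C ρ ρ₁ ∧ BigSteps K ρ₁ ρ'

/-- A transition of a pure command stays in its frame, and preserves divergence. -/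
theorem Step.of_isPure {Γ : Context} {o : ObjId} {C : Cmd} {K L : List Cmd} {ρ : Reg}
    {Θ : List Frame} {σ : Store} {t : State} (hC : C.IsPure)
    (h : Step Γ ⟨⟨o, C :: (K ++ L), ρ⟩ :: Θ, σ⟩ t) :
    ∃ K' ρ', t = ⟨⟨o, K' ++ (K ++ L), ρ'⟩ :: Θ, σ⟩ ∧ (∀ C' ∈ K', C'.IsPure) ∧
      ∀ ρ'', BigSteps (K' ++ K) ρ' ρ'' → BigSteps (C :: K) ρ ρ'' := by
  cases h with
  | call | store | load | check => exact hC.elim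
  | assign _ _ _ _ v _ _ _ he => exact ⟨[], _, rfl, by simp, fun ρ'' h => ⟨_, .assign he, h⟩⟩
  | skip => exact ⟨[], _, rfl, by simp, fun ρ'' h => ⟨_, .skip, h⟩⟩
  | seq _ _ C₁ C₂ =>
    refine ⟨[C₁, C₂], ρ, rfl, by simpa using (show C₁.IsPure ∧ C₂.IsPure from hC), ?_⟩
    rintro ρ'' ⟨ρ₁, h₁, ρ₂, h₂, h₃⟩
    exact ⟨ρ₂, .seq h₁ h₂, h₃⟩
  | ifTrue _ _ b C₁ C₂ _ _ _ hb =>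
    refine ⟨[C₁], ρ, rfl, by simpa using hC.1, ?_⟩
    rintro ρ'' ⟨ρ₁, h₁, h₂⟩
    exact ⟨ρ₁, .ifTrue hb h₁, h₂⟩
  | ifFalse _ _ b C₁ C₂ _ _ _ hb =>
    refine ⟨[C₂], ρ, rfl, by simpa using hC.2, ?_⟩
    rintro ρ'' ⟨ρ₁, h₁, h₂⟩
    exact ⟨ρ₁, .ifFalse hb h₁, h₂⟩
  | loopTrue _ _ b C _ _ _ hb =>
    refine ⟨[C, .loop b C], ρ, rfl, by simpa [Cmd.IsPure] using hC, ?_⟩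
    rintro ρ'' ⟨ρ₁, h₁, ρ₂, h₂, h₃⟩
    exact ⟨ρ₂, .loopTrue hb h₁ h₂, h₃⟩
  | loopFalse _ _ b C _ _ _ hb =>
    exact ⟨[], ρ, rfl, by simp, fun ρ'' h => ⟨_, .loopFalse hb, h⟩⟩

/-! ## The contracts -/

/-- The rule `ret` blocks unless `retVar` has a value. -/
def retCmd : Cmd := .assign retVar (.const 0)

/-- Write `-2` into the field. -/
def finishCmd : Cmd := .seq (.assign 4 (.const (-2))) (.store 0 4)

/-- The tails of `lockCmd` have names so that the remaining code of a frame can be written down in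
`Trapped` and `activeStates`. -/
def checkCmd : Cmd := .check (.eq (.var 4) (.const (-2)))
def reloadCmd : Cmd := .seq (.load 4 0) checkCmd
def callCmd (o : ObjId) : Cmd := .seq (.call 4 (o + 1) (.const 0)) reloadCmd
def storeCallCmd (o : ObjId) : Cmd := .seq (.store 0 4) (callCmd o)

/-- Write `-1` into the field, call another contract, and require that the field has become `-2`. -/
def lockCmd (o : ObjId) : Cmd := .seq (.assign 4 (.const (-1))) (storeCallCmd o)

def argCmd (o : ObjId) (U : Cmd) : Cmd :=
  .ifThenElse (.eq (.var argVar) (.const 0)) (lockCmd o) (.seq U finishCmd)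

def fieldCmd (o : ObjId) (U : Cmd) : Cmd :=
  .ifThenElse (.eq (.var 3) (.const (-1))) finishCmd (argCmd o U)

/-- The body of the method of `o`. While the field is `-1`, an invocation sets it to `-2`. Otherwise
an invocation with argument `0` sets it to `-1`, relies on a callback to set it to `-2`, and blocks
if there is none; an invocation with another argument runs `U` on the value of the field, and then
sets it to `-2`. -/
def bodyCmd (o : ObjId) (U : Cmd) : Cmd := .seq (.load 3 0) (.seq (fieldCmd o U) retCmd)

/-- The body of the method that calls `o` back. -/
def callbackCmd (o : ObjId) : Cmd := .seq (.call 4 o (.const 0)) retCmd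

def context (o : ObjId) (U : Cmd) : Context :=
  (Finmap.singleton (o + 1) (callbackCmd o)).insert o (bodyCmd o U)

/-- The store in which the field of `o` is `v`. -/
def storeWith (o : ObjId) (v : ℤ) : Store :=
  (Finmap.singleton (o + 1) (∅ : ObjState)).insert o (Finmap.singleton 0 v)

theorem context_lookup_self (o : ObjId) (U : Cmd) :
    (context o U).lookup o = some (bodyCmd o U) := by simp [context]

theorem context_lookup_succ (o : ObjId) (U : Cmd) :
    (context o U).lookup (o + 1) = some (callbackCmd o) := by
  rw [context, Finmap.lookup_insert_of_ne _ (Nat.succ_ne_self o), Finmap.lookup_singleton_eq]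

theorem storeWith_lookup_self (o : ObjId) (v : ℤ) :
    (storeWith o v).lookup o = some (Finmap.singleton 0 v) := by simp [storeWith]

theorem mem_storeWith_self (o : ObjId) (v : ℤ) : o ∈ storeWith o v := by simp [storeWith]

theorem mem_storeWith_succ (o : ObjId) (v : ℤ) : o + 1 ∈ storeWith o v := by simp [storeWith]

theorem storeWith_update (o : ObjId) (v w : ℤ) :
    (storeWith o v).insert o ((Finmap.singleton 0 v : ObjState).insert 0 w) = storeWith o w := by
  simp [storeWith]

theorem fieldsDisjoint_storeWith (o : ObjId) (v : ℤ) : FieldsDisjoint (storeWith o v) := by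
  intro o₁ o₂ μ₁ μ₂ h₁ h₂ hne F hF₁ hF₂
  -- Only `o` has any field at all.
  have key : ∀ (o₁ : ℕ) (μ : ObjState), (storeWith o v).lookup o₁ = some μ → F ∈ μ → o₁ = o := by
    intro o₁ μ h hF
    by_contra hne
    rw [storeWith, Finmap.lookup_insert_of_ne _ hne] at h
    by_cases h' : o₁ = o + 1
    · subst h'
      rw [Finmap.lookup_singleton_eq] at h
      cases h
      exact Finmap.notMem_empty hF
    · rw [Finmap.lookup_eq_none.2 (by simpa using h')] at h
      cases h
  exact hne ((key _ _ h₁ hF₁).trans (key _ _ h₂ hF₂).symm)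

/-! ## A callback-free run, if the computation terminates -/

/-- A sequence of transitions between the end points of a path. -/
theorem exists_execution {R : State → State → Prop} {s t : State}
    (h : Relation.ReflTransGen R s t) (τ : Transition) (hτ : τ.src = t) :
    ∃ ξ : Execution, (∀ τ ∈ ξ, R τ.src τ.trg) ∧ WellFormed (ξ ++ [τ]) ∧
      (ξ ++ [τ]).head?.map Transition.src = some s := by
  induction h using Relation.ReflTransGen.head_induction_on with
  | refl => exact ⟨[], by simp, by simp [WellFormed], by simp [hτ]⟩
  | @head a b hab _ ih =>
    obtain ⟨ξ, h₁, h₂, h₃⟩ := ih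
    refine ⟨⟨a, b⟩ :: ξ, by simpa using ⟨hab, h₁⟩, ?_, by simp⟩
    rw [List.cons_append, WellFormed, List.isChain_cons]
    refine ⟨fun y hy => ?_, h₂⟩
    rw [Option.mem_def.1 hy] at h₃
    simpa using h₃.symm

/-- Transitions between states with disjoint fields and just one frame. -/
def SingleStep (Γ : Context) (s t : State) : Prop :=
  Step Γ s t ∧ (FieldsDisjoint s.store ∧ ∃ f, s.stack = [f]) ∧
    FieldsDisjoint t.store ∧ ∃ f, t.stack = [f]

/-- In the same context, `o` is invoked with a nonzero argument. It runs `U`, writes `-2` and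
returns; the stack never has more than one frame, whereas a callback needs three. -/
theorem decf_of_terminates {o : ObjId} {U : Cmd} {n : ℕ} {ξ : Execution}
    (hξ₁ : (firstState ξ).map (fun s => s.store.lookup o) = some ((storeWith o n).lookup o))
    (hξ₂ : (lastState ξ).map (fun s => s.store.lookup o) = some ((storeWith o (-2)).lookup o))
    (hU : ∀ ρ, ρ.lookup 3 = some (n : ℤ) → ∃ ρ', BigStep U ρ ρ') :
    DECF o (context o U) ξ := by
  set Γ := context o U
  let st (v : ℤ) (K : List Cmd) (ρ : Reg) : State := ⟨[⟨o, K, ρ⟩], storeWith o v⟩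
  have good : ∀ v K ρ, FieldsDisjoint (st v K ρ).store ∧ ∃ f, (st v K ρ).stack = [f] :=
    fun v K ρ => ⟨fieldsDisjoint_storeWith o v, _, rfl⟩
  have lift : ∀ {v v' K K' ρ ρ'}, Step Γ (st v K ρ) (st v' K' ρ') →
      Relation.ReflTransGen (SingleStep Γ) (st v K ρ) (st v' K' ρ') :=
    fun h => .single ⟨h, good _ _ _, good _ _ _⟩
  have big : ∀ {C ρ ρ'} v K, BigStep C ρ ρ' →
      Relation.ReflTransGen (SingleStep Γ) (st v (C :: K) ρ) (st v K ρ') := by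
    intro C ρ ρ' v K h
    exact (h.localSteps K).lift (fun a : List Cmd × Reg => st v a.1 a.2)
      fun a b hab => ⟨hab Γ o [] _, good _ _ _, good _ _ _⟩
  -- Any argument other than `0` selects the branch that runs `U`.
  set ρ₀ : Reg := Finmap.singleton argVar 1
  obtain ⟨ρ₁, hρ₁⟩ := hU (ρ₀.insert 3 n) (by simp)
  have path : Relation.ReflTransGen (SingleStep Γ) (st n [bodyCmd o U] ρ₀)
      (st (-2) [] ((ρ₁.insert 4 (-2)).insert retVar 0)) := by
    refine (lift (.seq _ _ _ _ _ _ _)).trans ?_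
    refine (lift (.load _ _ _ _ n _ _ _ _ (storeWith_lookup_self o n) (by simp))).trans ?_
    refine (lift (.seq _ _ _ _ _ _ _)).trans ?_
    refine (lift (.ifFalse _ _ _ _ _ _ _ _ (by simp [BExpr.eval, Expr.eval]))).trans ?_
    refine (lift (.ifFalse _ _ _ _ _ _ _ _
      (by simp [BExpr.eval, Expr.eval, argVar, ρ₀]))).trans ?_
    refine (lift (.seq _ _ _ _ _ _ _)).trans ?_
    refine (big _ _ hρ₁).trans ?_
    refine (lift (.seq _ _ _ _ _ _ _)).trans ?_
    refine (big _ _ (.assign rfl)).trans ?_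
    refine .trans (lift (v' := -2) (K' := [retCmd]) (ρ' := ρ₁.insert 4 (-2)) ?_)
      (big _ _ (.assign rfl))
    have := Step.store (Γ := Γ) (storeWith o n) o 0 4 (-2) _ [retCmd] (ρ₁.insert 4 (-2)) []
      (by simp) (storeWith_lookup_self o n) (by simp)
    rwa [storeWith_update] at this
  set τ₁ : Transition := ⟨⟨[], storeWith o n⟩, st n [bodyCmd o U] ρ₀⟩
  set τ₂ : Transition :=
    ⟨st (-2) [] ((ρ₁.insert 4 (-2)).insert retVar 0), ⟨[], storeWith o (-2)⟩⟩
  obtain ⟨ζ, hζ, hw, hh⟩ := exists_execution path τ₂ rfl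
  have hinv : Step Γ ⟨[], storeWith o n⟩ (st n [bodyCmd o U] ρ₀) :=
    .invoke _ o _ 1 (context_lookup_self o U) (mem_storeWith_self o _)
  have nocb : ∀ Θ : List Frame, Θ.length ≤ 1 → ¬ StackCallback o Θ := by
    rintro Θ hΘ ⟨a, b, c, h, -⟩
    have := h.length_le
    simp only [List.length_cons] at this
    omega
  refine ⟨Γ, τ₁ :: (ζ ++ [τ₂]), ⟨[τ₁ :: (ζ ++ [τ₂])], by simp, ?_, by simp⟩, ?_, ⟨?_, ?_, rfl⟩, ?_⟩
  · simp only [List.mem_singleton, forall_eq]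
    refine ⟨?_, _, ζ, _, rfl, rfl, rfl, fun t ht => ?_⟩
    · intro τ hτ
      simp only [List.mem_cons, List.mem_append, List.not_mem_nil, or_false] at hτ
      rcases hτ with rfl | hτ | rfl
      · exact ⟨hinv, fieldsDisjoint_storeWith _ _, fieldsDisjoint_storeWith _ _⟩
      · exact ⟨(hζ _ hτ).1, (hζ _ hτ).2.1.1, (hζ _ hτ).2.2.1⟩
      · exact ⟨.exit _ _ _, fieldsDisjoint_storeWith _ _, fieldsDisjoint_storeWith _ _⟩
    · obtain ⟨-, ⟨-, f, hf⟩, -, g, hg⟩ := hζ _ ht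
      simp [State.Quiescent, hf, hg]
  · rw [WellFormed, List.isChain_cons]
    refine ⟨fun y hy => ?_, hw⟩
    rw [Option.mem_def.1 hy] at hh
    simpa using hh.symm
  · rw [hξ₁]; rfl
  · rw [hξ₂, lastState, ← List.cons_append, List.getLast?_concat]; rfl
  · rintro ⟨τ, hτ, hcb⟩
    simp only [List.mem_cons, List.mem_append, List.not_mem_nil, or_false] at hτ
    rcases hτ with rfl | hτ | rfl
    · exact hcb.elim (nocb _ (Nat.zero_le _)) (nocb _ le_rfl)
    · obtain ⟨-, ⟨-, f, hf⟩, -, g, hg⟩ := hζ _ hτ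
      rw [hf, hg] at hcb
      exact hcb.elim (nocb _ le_rfl) (nocb _ le_rfl)
    · exact hcb.elim (nocb _ le_rfl) (nocb _ (Nat.zero_le _))

/-! ## No callback-free run, if the computation diverges -/

/-- The situations of a frame of `o`, and of the field of `o`, that can occur in a callback-free run
if `U` diverges on `n`, the initial value of the field. -/
inductive Trapped (o : ObjId) (U : Cmd) (n : ℕ) : List Cmd → Reg → ℤ → Prop
  | enter (ρ) : Trapped o U n [bodyCmd o U] ρ n
  | load (ρ) : Trapped o U n [.load 3 0, .seq (fieldCmd o U) retCmd] ρ n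
  | loaded (ρ) (h : ρ.lookup 3 = some (n : ℤ)) : Trapped o U n [.seq (fieldCmd o U) retCmd] ρ n
  | field (ρ) (h : ρ.lookup 3 = some (n : ℤ)) : Trapped o U n [fieldCmd o U, retCmd] ρ n
  | arg (ρ) (h : ρ.lookup 3 = some (n : ℤ)) : Trapped o U n [argCmd o U, retCmd] ρ n
  | lock (ρ) : Trapped o U n [lockCmd o, retCmd] ρ n
  | assign (ρ) : Trapped o U n [.assign 4 (.const (-1)), storeCallCmd o, retCmd] ρ n
  | storeCall (ρ) (h : ρ.lookup 4 = some (-1)) : Trapped o U n [storeCallCmd o, retCmd] ρ n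
  | store (ρ) (h : ρ.lookup 4 = some (-1)) : Trapped o U n [.store 0 4, callCmd o, retCmd] ρ n
  | stored (ρ) : Trapped o U n [callCmd o, retCmd] ρ (-1)
  | call (ρ) : Trapped o U n [.call 4 (o + 1) (.const 0), reloadCmd, retCmd] ρ (-1)
  | wait (ρ) : Trapped o U n [.assign 4 (.var resVar), reloadCmd, retCmd] ρ (-1)
  | returned (ρ) : Trapped o U n [reloadCmd, retCmd] ρ (-1)
  | reload (ρ) : Trapped o U n [.load 4 0, checkCmd, retCmd] ρ (-1)
  | check (ρ) (h : ρ.lookup 4 = some (-1)) : Trapped o U n [checkCmd, retCmd] ρ (-1)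
  | run (ρ) (h : ρ.lookup 3 = some (n : ℤ)) : Trapped o U n [.seq U finishCmd, retCmd] ρ n
  | diverge (K ρ) (hK : ∀ C ∈ K, C.IsPure) (h : ∀ ρ', ¬ BigSteps K ρ ρ') :
      Trapped o U n (K ++ [finishCmd, retCmd]) ρ n

/-- The code that waits for the end of the call in `lockCmd`. -/
def waitCmds : List Cmd := [.assign 4 (.var resVar), reloadCmd, retCmd]

/-- There are three ways out, all closed: the test for `-1` at the start fails because the frame was
entered with the field at `n ≥ 0`; `checkCmd` fails because the field is still `-1`; and `finishCmd`
after `U` is not reached because `U` diverges. The frame cannot return, as its remaining code is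
never empty. It can only be suspended by the call in `lockCmd`, and then the field is `-1`. -/
theorem Trapped.step {o : ObjId} {U : Cmd} {n : ℕ} (hU : U.IsPure)
    (hdiv : ∀ ρ ρ', ρ.lookup 3 = some (n : ℤ) → ¬ BigStep U ρ ρ')
    {K : List Cmd} {ρ : Reg} {v : ℤ} (hK : Trapped o U n K ρ v)
    {Γ : Context} {Θ : List Frame} {σ : Store} {t : State}
    (hσ : σ.lookup o = some (Finmap.singleton 0 v)) (h : Step Γ ⟨⟨o, K, ρ⟩ :: Θ, σ⟩ t) :
    (∃ K' ρ' σ' v', t = ⟨⟨o, K', ρ'⟩ :: Θ, σ'⟩ ∧ Trapped o U n K' ρ' v' ∧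
      σ'.lookup o = some (Finmap.singleton 0 v')) ∨
    ∃ C w, v = -1 ∧ t = ⟨Frame.enter (o + 1) C w :: ⟨o, waitCmds, ρ⟩ :: Θ, σ⟩ := by
  cases hK with
  | enter => cases h; exact .inl ⟨_, _, _, _, rfl, .load _, hσ⟩
  | load =>
    cases h with
    | load _ _ _ _ w μ _ _ _ hμ hF =>
      rw [hσ] at hμ
      cases hμ
      rw [Finmap.lookup_singleton_eq] at hF
      cases hF
      exact .inl ⟨_, _, _, _, rfl, .loaded _ (by simp), hσ⟩
  | loaded _ h₃ => cases h; exact .inl ⟨_, _, _, _, rfl, .field _ h₃, hσ⟩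
  | field _ h₃ =>
    cases h with
    | ifTrue _ _ _ _ _ _ _ _ hb =>
      simp [BExpr.eval, Expr.eval, h₃] at hb
    | ifFalse => exact .inl ⟨_, _, _, _, rfl, .arg _ h₃, hσ⟩
  | arg _ h₃ =>
    cases h with
    | ifTrue => exact .inl ⟨_, _, _, _, rfl, .lock _, hσ⟩
    | ifFalse => exact .inl ⟨_, _, _, _, rfl, .run _ h₃, hσ⟩
  | lock => cases h; exact .inl ⟨_, _, _, _, rfl, .assign _, hσ⟩
  | assign =>
    cases h with
    | assign _ _ _ _ w _ _ _ he =>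
      cases he
      exact .inl ⟨_, _, _, _, rfl, .storeCall _ (by simp), hσ⟩
  | storeCall _ h₄ => cases h; exact .inl ⟨_, _, _, _, rfl, .store _ h₄, hσ⟩
  | store _ h₄ =>
    cases h with
    | store _ _ _ _ w μ _ _ _ hx hμ =>
      rw [h₄] at hx
      cases hx
      rw [hσ] at hμ
      cases hμ
      exact .inl ⟨_, _, _, _, rfl, .stored _, by simp⟩
  | stored => cases h; exact .inl ⟨_, _, _, _, rfl, .call _, hσ⟩
  | call => cases h; exact .inr ⟨_, _, rfl, rfl⟩
  | wait => cases h; exact .inl ⟨_, _, _, _, rfl, .returned _, hσ⟩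
  | returned => cases h; exact .inl ⟨_, _, _, _, rfl, .reload _, hσ⟩
  | reload =>
    cases h with
    | load _ _ _ _ w μ _ _ _ hμ hF =>
      rw [hσ] at hμ
      cases hμ
      rw [Finmap.lookup_singleton_eq] at hF
      cases hF
      exact .inl ⟨_, _, _, _, rfl, .check _ (by simp), hσ⟩
  | check _ h₄ =>
    cases h with
    | check _ _ _ _ _ _ hb => simp [BExpr.eval, Expr.eval, h₄] at hb
  | run _ h₃ =>
    cases h
    refine .inl ⟨_, _, _, _, rfl, .diverge [U] _ (by simpa using hU) ?_, hσ⟩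
    rintro ρ' ⟨ρ₁, h₁, -⟩
    exact hdiv _ _ h₃ h₁
  | diverge K _ hK hd =>
    cases K with
    -- If nothing of `U` were left, `U` would have terminated.
    | nil => exact (hd ρ rfl).elim
    | cons C K =>
      obtain ⟨K', ρ', rfl, hK', hb⟩ := Step.of_isPure (hK C (by simp)) h
      refine .inl ⟨_, _, _, _, rfl, ?_, hσ⟩
      rw [← List.append_assoc]
      refine .diverge _ _ (fun C' h' => ?_) fun ρ'' h' => hd _ (hb _ h')
      rcases List.mem_append.1 h' with h' | h'
      exacts [hK' _ h', hK _ (List.mem_cons_of_mem _ h')]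

/-- A transition of a frame of another object does not touch the fields of `o`. -/
theorem Step.of_ne {Γ : Context} {o : ObjId} {f : Frame} {Θ : List Frame} {σ : Store} {t : State}
    (hf : f.obj ≠ o) (h : Step Γ ⟨f :: Θ, σ⟩ t) :
    t.store.lookup o = σ.lookup o ∧
      ((∃ f' : Frame, t.stack = f' :: Θ ∧ f'.obj ≠ o) ∨
       (∃ (f' : Frame) (o' : ObjId) (C : Cmd) (v : ℤ),
          t.stack = Frame.enter o' C v :: f' :: Θ ∧ f'.obj ≠ o ∧ Γ.lookup o' = some C) ∨
       (∃ (g : Frame) (Θ' : List Frame) (ρ : Reg), Θ = g :: Θ' ∧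
          t.stack = { g with env := ρ } :: Θ') ∨
       Θ = [] ∧ t.stack = []) := by
  cases h with
  | call _ _ _ _ _ _ _ _ _ _ _ hC => exact ⟨rfl, .inr (.inl ⟨_, _, _, _, rfl, hf, hC⟩)⟩
  | ret => exact ⟨rfl, .inr (.inr (.inl ⟨_, _, _, rfl, rfl⟩))⟩
  | exit => exact ⟨rfl, .inr (.inr (.inr ⟨rfl, rfl⟩))⟩
  | store => exact ⟨Finmap.lookup_insert_of_ne _ (Ne.symm hf), .inl ⟨_, rfl, hf⟩⟩
  | _ => exact ⟨rfl, .inl ⟨_, rfl, hf⟩⟩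

/-- The invariant of callback-free runs if `U` diverges on `n`: no frame of `o` is on the stack, or
the only one is at the top, or the only one waits in `lockCmd` for the end of the call. -/
def Invariant (o : ObjId) (U : Cmd) (n : ℕ) (s : State) : Prop :=
  ((∀ f ∈ s.stack, f.obj ≠ o) ∧ s.store.lookup o = some (Finmap.singleton 0 (n : ℤ))) ∨
  (∃ K ρ Θ v, s.stack = ⟨o, K, ρ⟩ :: Θ ∧ (∀ f ∈ Θ, f.obj ≠ o) ∧ Trapped o U n K ρ v ∧
    s.store.lookup o = some (Finmap.singleton 0 v)) ∨
  (∃ f Θ₁ ρ Θ₂, s.stack = f :: (Θ₁ ++ ⟨o, waitCmds, ρ⟩ :: Θ₂) ∧ f.obj ≠ o ∧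
    (∀ g ∈ Θ₁, g.obj ≠ o) ∧ (∀ g ∈ Θ₂, g.obj ≠ o) ∧
    s.store.lookup o = some (Finmap.singleton 0 (-1)))

/-- Frames of other objects, whatever their code, leave the field of `o` alone. So an invocation of
`o` from a stack without frames of `o` finds `n`, and while a frame of `o` waits, the field stays
`-1` unless `o` is entered again, which would be a callback. -/
theorem Invariant.step {o : ObjId} {U : Cmd} {n : ℕ} (hU : U.IsPure)
    (hdiv : ∀ ρ ρ', ρ.lookup 3 = some (n : ℤ) → ¬ BigStep U ρ ρ') {Γ : Context}
    (hΓ : Γ.lookup o = some (bodyCmd o U)) {s t : State} (hs : Invariant o U n s)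
    (h : Step Γ s t) (hcb : ¬ StackCallback o t.stack) : Invariant o U n t := by
  obtain ⟨Θ, σ⟩ := s
  rcases hs with ⟨hΘ, hσ⟩ | ⟨K, ρ, Θ', v, rfl, hΘ, hK, hσ⟩ | ⟨f, Θ₁, ρ, Θ₂, rfl, hf, h₁, h₂, hσ⟩
  · dsimp only at hΘ hσ
    rcases Θ with _ | ⟨f, Θ⟩
    · cases h with
      | invoke _ o' C m hC =>
        by_cases ho : o' = o
        · subst ho
          rw [hΓ] at hC
          cases hC
          exact .inr (.inl ⟨_, _, [], _, rfl, by simp, .enter _, hσ⟩)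
        · exact .inl ⟨by simpa [Frame.enter] using ho, hσ⟩
    · simp only [List.mem_cons, forall_eq_or_imp] at hΘ
      obtain ⟨hf, hΘ⟩ := hΘ
      obtain ⟨hσ', h⟩ := h.of_ne hf
      rw [hσ] at hσ'
      rcases h with ⟨f', ht, hf'⟩ | ⟨f', o', C, v, ht, hf', hC⟩ | ⟨g, Θ', ρ, rfl, ht⟩ | ⟨-, ht⟩
      · exact .inl ⟨by simpa [ht] using ⟨hf', hΘ⟩, hσ'⟩
      · by_cases ho : o' = o
        · subst ho
          rw [hΓ] at hC
          cases hC
          exact .inr (.inl ⟨_, _, _, _, ht, by simpa using ⟨hf', hΘ⟩, .enter _, hσ'⟩)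
        · exact .inl ⟨by simpa [ht, Frame.enter] using ⟨ho, hf', hΘ⟩, hσ'⟩
      · exact .inl ⟨by simpa [ht] using hΘ, hσ'⟩
      · exact .inl ⟨by simp [ht], hσ'⟩
  · rcases hK.step hU hdiv hσ h with ⟨K', ρ', σ', v', rfl, hK', hσ'⟩ | ⟨C, w, rfl, rfl⟩
    · exact .inr (.inl ⟨_, _, _, _, rfl, hΘ, hK', hσ'⟩)
    · exact .inr (.inr ⟨_, [], _, _, rfl, Nat.succ_ne_self o, by simp, hΘ, hσ⟩)
  · obtain ⟨hσ', h⟩ := h.of_ne hf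
    dsimp only at hσ
    rw [hσ] at hσ'
    rcases h with ⟨f', ht, hf'⟩ | ⟨f', o', C, v, ht, hf', hC⟩ | ⟨g, Θ', ρ', hg, ht⟩ | ⟨hΘ, -⟩
    · exact .inr (.inr ⟨_, _, _, _, ht, hf', h₁, h₂, hσ'⟩)
    · by_cases ho : o' = o
      · subst ho
        -- The caller `f'` belongs to another object and separates the new frame of `o` from the
        -- waiting one.
        refine (hcb ⟨Frame.enter o' C v, f', ⟨o', waitCmds, ρ⟩, ?_, rfl, hf', rfl⟩).elim
        rw [ht]
        exact .cons_cons _ (.cons_cons _ (by simp))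
      · exact .inr (.inr ⟨_, f' :: Θ₁, _, _, ht, ho, by simpa using ⟨hf', h₁⟩, h₂, hσ'⟩)
    · rcases Θ₁ with _ | ⟨f', Θ₁⟩
      · cases hg
        -- The returned value is irrelevant: the waiting frame resumes with the field at `-1`.
        exact .inr (.inl ⟨_, _, _, _, ht, h₂, .wait _, hσ'⟩)
      · cases hg
        simp only [List.mem_cons, forall_eq_or_imp] at h₁
        exact .inr (.inr ⟨_, Θ₁, _, _, ht, h₁.1, h₁.2, h₂, hσ'⟩)
    · simp at hΘ

theorem Invariant.execution {o : ObjId} {U : Cmd} {n : ℕ} (hU : U.IsPure)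
    (hdiv : ∀ ρ ρ', ρ.lookup 3 = some (n : ℤ) → ¬ BigStep U ρ ρ') {Γ : Context}
    (hΓ : Γ.lookup o = some (bodyCmd o U)) :
    ∀ {ξ : Execution} {s t : State}, IsExecution Γ ξ → WellFormed ξ → ¬ HasCallback o ξ →
      firstState ξ = some s → lastState ξ = some t → Invariant o U n s → Invariant o U n t
  | [], _, _, _, _, _, h, _, _ => by cases h
  | [τ], s, t, hξ, _, hcb, hs, ht, hi => by
    cases hs
    cases ht
    exact hi.step hU hdiv hΓ (hξ τ (by simp)).1 fun h => hcb ⟨τ, by simp, .inr h⟩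
  | τ :: τ' :: ξ, s, t, hξ, hw, hcb, hs, ht, hi => by
    cases hs
    rw [WellFormed, List.isChain_cons_cons] at hw
    have h := hi.step hU hdiv hΓ (hξ τ (by simp)).1 fun h => hcb ⟨τ, by simp, .inr h⟩
    refine Invariant.execution hU hdiv hΓ (ξ := τ' :: ξ) (fun τ h => hξ τ (by simp [h])) hw.2
      (fun ⟨τ, h, h'⟩ => hcb ⟨τ, by simp [h], h'⟩) (by simp [firstState]; exact hw.1.symm) ?_ h
    simpa [lastState] using ht

/-- A run starts and ends with an empty stack. The invariant holds at the start, and with an empty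
stack it leaves only one possibility at the end: the field is `n`, which is a natural number and so
differs from `-2`. -/
theorem not_decf_of_diverges {o : ObjId} {U : Cmd} {n : ℕ} {ξ : Execution}
    (hξ₁ : (firstState ξ).map (fun s => s.store.lookup o) = some ((storeWith o n).lookup o))
    (hξ₂ : (lastState ξ).map (fun s => s.store.lookup o) = some ((storeWith o (-2)).lookup o))
    (hU : U.IsPure) (hdiv : ∀ ρ ρ', ρ.lookup 3 = some (n : ℤ) → ¬ BigStep U ρ ρ') :
    ¬ DECF o (context o U) ξ := by
  rintro ⟨Γ, ζ, ⟨ζs, hne, hζs, hζ⟩, hw, ⟨h₁, h₂, h₃⟩, hcb⟩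
  rw [context_lookup_self] at h₃
  rw [hξ₁] at h₁
  rw [hξ₂] at h₂
  obtain ⟨s, hs, hsσ⟩ := Option.map_eq_some_iff.1 h₁.symm
  obtain ⟨t, ht, htσ⟩ := Option.map_eq_some_iff.1 h₂.symm
  rw [storeWith_lookup_self] at hsσ htσ
  have hex : IsExecution Γ ζ := by
    intro τ hτ
    rw [hζ, List.mem_flatten] at hτ
    obtain ⟨η, hη, hτ⟩ := hτ
    exact (hζs η hη).1 τ hτ
  have hsq : s.stack = [] := by
    rcases ζs with _ | ⟨η, ζs⟩
    · exact (hne rfl).elim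
    obtain ⟨-, τ, η', τ', rfl, hq, -, -⟩ := hζs η (by simp)
    rw [hζ] at hs
    cases hs
    exact hq
  have htq : t.stack = [] := by
    obtain ⟨ζs, η, rfl⟩ := List.eq_nil_or_concat'  ζs |>.resolve_left hne
    obtain ⟨-, τ, η', τ', rfl, -, hq, -⟩ := hζs η (by simp)
    rw [hζ, lastState] at ht
    simp [List.getLast?_cons] at ht
    rw [← ht]
    exact hq
  have := Invariant.execution (n := n) hU hdiv h₃.symm hex hw hcb hs ht (.inl ⟨by simp [hsq], hsσ⟩)
  rcases this with ⟨-, h⟩ | ⟨K, ρ, Θ, v, h, -⟩ | ⟨f, Θ₁, ρ, Θ₂, h, -⟩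
  · rw [htσ, Option.some_inj] at h
    have := congrArg (Finmap.lookup 0) h
    simp at this
  · simp [htq] at h
  · simp [htq] at h

/-! ## Executions from sequences of states -/

/-- The execution that passes through the given states. -/
def path : List State → Execution
  | [] => []
  | [_] => []
  | s :: t :: l => ⟨s, t⟩ :: path (t :: l)

/-- `IsComplete` asks for the last transition to be split off. -/
theorem path_concat (a t : State) : ∀ l, ∃ b, path (a :: (l ++ [t])) = path (a :: l) ++ [⟨b, t⟩]
  | [] => ⟨a, rfl⟩
  | a' :: l => (path_concat a' t l).imp fun b h => by
      change _ :: path (a' :: (l ++ [t])) = _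
      rw [h]
      rfl

theorem mem_path {l : List State} {τ : Transition} (h : τ ∈ path l) : τ.src ∈ l ∧ τ.trg ∈ l := by
  induction l using path.induct with
  | case1 | case2 => simp [path] at h
  | case3 s t l ih =>
    rw [path, List.mem_cons] at h
    rcases h with rfl | h
    · simp
    · exact (ih h).imp (List.mem_cons_of_mem _) (List.mem_cons_of_mem _)

theorem wellFormed_path (l : List State) : WellFormed (path l) := by
  induction l using path.induct with
  | case1 | case2 => simp [path, WellFormed]
  | case3 s t l ih =>
    rcases l with _ | ⟨u, l⟩
    · simp [path, WellFormed]
    · exact List.isChain_cons_cons.2 ⟨rfl, ih⟩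

theorem step_of_mem_path {Γ : Context} {l : List State} (hl : l.IsChain (Step Γ)) {τ : Transition}
    (h : τ ∈ path l) : Step Γ τ.src τ.trg := by
  induction l using path.induct with
  | case1 | case2 => simp [path] at h
  | case3 s t l ih =>
    rw [List.isChain_cons_cons] at hl
    rw [path, List.mem_cons] at h
    rcases h with rfl | h
    exacts [hl.1, ih hl.2 h]

theorem isComplete_path {Γ : Context} {s a t : State} {l : List State}
    (hl : (s :: a :: (l ++ [t])).IsChain (Step Γ)) (hs : s.Quiescent) (ht : t.Quiescent)
    (hq : ∀ u ∈ a :: l, ¬ u.Quiescent)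
    (hd : ∀ u ∈ s :: a :: (l ++ [t]), FieldsDisjoint u.store) :
    IsComplete Γ (path (s :: a :: (l ++ [t]))) := by
  refine ⟨fun τ h => ⟨step_of_mem_path hl h, hd _ (mem_path h).1, hd _ (mem_path h).2⟩, ?_⟩
  obtain ⟨b, hb⟩ := path_concat a t l
  refine ⟨⟨s, a⟩, path (a :: l), ⟨b, t⟩, by rw [path, hb], hs, ht, fun τ h => ?_⟩
  exact ⟨hq _ (mem_path h).1, hq _ (mem_path h).2⟩

/-! ## Computability of codes -/

theorem computable_natPair {f g : ℕ → ℕ} (hf : Computable f) (hg : Computable g) :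
    Computable fun n => Nat.pair (f n) (g n) :=
  Primrec₂.natPair.to_comp.comp hf hg

/-- The length of the list does not depend on `n`, so the code is a fixed nest of pairings of
computable functions. -/
theorem computable_listCode {α : Type} {c : α → ℕ} (l : List (ℕ → α))
    (h : ∀ f ∈ l, Computable fun n => c (f n)) :
    Computable fun n => listCode c (l.map (· n)) := by
  induction l with
  | nil => exact Computable.const 0
  | cons f l ih =>
    exact Computable.succ.comp (computable_natPair (h f (by simp))
      (ih fun g hg => h g (List.mem_cons_of_mem _ hg)))

/-- A computable family of finite maps with a fixed domain. -/
def UniformMap {α : Type} (c : α → ℕ) (m : ℕ → PMap α) : Prop :=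
  ∃ ks : Finset ℕ, (∀ n, (m n).keys = ks) ∧ ∀ k, Computable fun n => ((m n).lookup k).elim 0 c

namespace UniformMap

variable {α : Type} {c : α → ℕ}

/-- The sorted list of keys is the same for all `n`, so that again only the entries vary. -/
theorem computable {m : ℕ → PMap α} (h : UniformMap c m) : Computable fun n => pmapCode c (m n) := by
  obtain ⟨ks, h₁, h₂⟩ := h
  simp only [pmapCode, h₁]
  generalize ks.sort = l
  induction l with
  | nil => exact Computable.const 0
  | cons k l ih =>
    exact Computable.succ.comp (computable_natPair (computable_natPair (.const k) (h₂ k)) ih)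

theorem empty : UniformMap c fun _ => ∅ :=
  ⟨∅, fun _ => Finmap.keys_empty, fun k => by simpa using Computable.const 0⟩

theorem insert {m : ℕ → PMap α} (h : UniformMap c m) (k : ℕ) {v : ℕ → α}
    (hv : Computable fun n => c (v n)) : UniformMap c fun n => (m n).insert k (v n) := by
  obtain ⟨ks, h₁, h₂⟩ := h
  refine ⟨Insert.insert k ks, fun n => ?_, fun j => ?_⟩
  · ext j
    rw [Finmap.mem_keys, Finmap.mem_insert, Finset.mem_insert, ← h₁ n, Finmap.mem_keys]
  · by_cases hj : j = k
    · subst hj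
      simpa using hv
    · simpa only [Finmap.lookup_insert_of_ne _ hj] using h₂ j

theorem singleton (k : ℕ) {v : ℕ → α} (hv : Computable fun n => c (v n)) :
    UniformMap c fun n => Finmap.singleton k (v n) := by
  have h : ∀ n, (Finmap.singleton k (v n) : PMap α) = (∅ : PMap α).insert k (v n) := fun n => rfl
  simpa only [h] using empty.insert k hv

end UniformMap

theorem computable_intCode_natCast : Computable fun n : ℕ => intCode n :=
  (Primrec.nat_mul.comp (.const 2) .id).to_comp

theorem uniformMap_storeWith (o : ObjId) {v : ℕ → ℤ} (hv : Computable fun n => intCode (v n)) :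
    UniformMap (pmapCode intCode) fun n => storeWith o (v n) :=
  (UniformMap.singleton (o + 1) (.const _)).insert o (UniformMap.singleton 0 hv).computable

/-- A family of states with a fixed shape. -/
def family (o : ObjId) (Θ : List (ObjId × List Cmd × (ℕ → Reg))) (v : ℕ → ℤ) (n : ℕ) : State :=
  ⟨Θ.map fun f => ⟨f.1, f.2.1, f.2.2 n⟩, storeWith o (v n)⟩

theorem computable_family (o : ObjId) {Θ : List (ObjId × List Cmd × (ℕ → Reg))} {v : ℕ → ℤ}
    (hΘ : ∀ f ∈ Θ, UniformMap intCode f.2.2) (hv : Computable fun n => intCode (v n)) :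
    Computable fun n => (family o Θ v n).code := by
  refine computable_natPair ?_ (uniformMap_storeWith o hv).computable
  have := computable_listCode (c := Frame.code)
    (Θ.map fun f n => (⟨f.1, f.2.1, f.2.2 n⟩ : Frame)) ?_
  · simpa [List.map_map, Function.comp_def, family] using this
  · intro f hf
    obtain ⟨g, hg, rfl⟩ := List.mem_map.1 hf
    exact computable_natPair (.const _) (computable_natPair
      (.const (listCode Cmd.code g.2.1)) (hΘ g hg).computable)

theorem computable_path (l : List (ℕ → State)) (h : ∀ s ∈ l, Computable fun n => (s n).code) :
    Computable fun n => listCode Transition.code (path (l.map (· n))) := by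
  induction l with
  | nil => exact Computable.const 0
  | cons s l ih =>
    rcases l with _ | ⟨t, l⟩
    · exact Computable.const 0
    · exact Computable.succ.comp (computable_natPair
        (computable_natPair (h s (by simp)) (h t (by simp)))
        (ih fun g hg => h g (List.mem_cons_of_mem _ hg)))

/-! ## An execution with a callback -/

theorem Step.load_storeWith {Γ : Context} {o : ObjId} {v : ℤ} {x : VarId} {K : List Cmd} {ρ : Reg}
    {Θ : List Frame} : Step Γ ⟨⟨o, .load x 0 :: K, ρ⟩ :: Θ, storeWith o v⟩
      ⟨⟨o, K, ρ.insert x v⟩ :: Θ, storeWith o v⟩ :=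
  .load _ _ _ _ _ _ _ _ _ (storeWith_lookup_self o v) (by simp)

theorem Step.store_storeWith {Γ : Context} {o : ObjId} {v w : ℤ} {x : VarId} {K : List Cmd}
    {ρ : Reg} {Θ : List Frame} (hx : ρ.lookup x = some w) :
    Step Γ ⟨⟨o, .store 0 x :: K, ρ⟩ :: Θ, storeWith o v⟩ ⟨⟨o, K, ρ⟩ :: Θ, storeWith o w⟩ := by
  have := Step.store (Γ := Γ) (storeWith o v) o 0 x w _ K ρ Θ hx (storeWith_lookup_self o v)
    (by simp)
  rwa [storeWith_update] at this

/-- The local environments along `callbackExecution`. All three invocations have argument `0` and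
start in `argReg`; the `inner` ones belong to the callback and the `middle` ones to `o + 1`. Only
the outer frame of `o`, once it has loaded the field, depends on `n`. -/
def argReg : Reg := Finmap.singleton argVar 0
def outerReg (n : ℕ) : Reg := argReg.insert 3 n
def lockedReg (n : ℕ) : Reg := (outerReg n).insert 4 (-1)
def returnedReg (n : ℕ) : Reg := (lockedReg n).insert resVar 0
def assignedReg (n : ℕ) : Reg := (returnedReg n).insert 4 0
def reloadedReg (n : ℕ) : Reg := (assignedReg n).insert 4 (-2)
def exitReg (n : ℕ) : Reg := (reloadedReg n).insert retVar 0
def innerReg : Reg := argReg.insert 3 (-1)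
def innerFinishReg : Reg := innerReg.insert 4 (-2)
def innerExitReg : Reg := innerFinishReg.insert retVar 0
def middleReg : Reg := argReg.insert resVar 0
def middleAssignedReg : Reg := middleReg.insert 4 0
def middleExitReg : Reg := middleAssignedReg.insert retVar 0

/-- The active states of an invocation of `o` with argument `0`, in which another contract calls
`o` back, after the first one. -/
def activeStates (o : ObjId) (U : Cmd) : List (ℕ → State) :=
  -- The suspended frames: `w` of the outer invocation of `o`, and `x` of `o + 1` during the
  -- callback.
  let w := (o, waitCmds, lockedReg)
  let x := (o + 1, [.assign 4 (.var resVar), retCmd], fun _ => argReg)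
  [ family o [(o, [.load 3 0, .seq (fieldCmd o U) retCmd], fun _ => argReg)] (fun n => n),
    family o [(o, [.seq (fieldCmd o U) retCmd], outerReg)] (fun n => n),
    family o [(o, [fieldCmd o U, retCmd], outerReg)] (fun n => n),
    family o [(o, [argCmd o U, retCmd], outerReg)] (fun n => n),
    family o [(o, [lockCmd o, retCmd], outerReg)] (fun n => n),
    family o [(o, [.assign 4 (.const (-1)), storeCallCmd o, retCmd], outerReg)] (fun n => n),
    family o [(o, [storeCallCmd o, retCmd], lockedReg)] (fun n => n),
    family o [(o, [.store 0 4, callCmd o, retCmd], lockedReg)] (fun n => n),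
    family o [(o, [callCmd o, retCmd], lockedReg)] (fun _ => -1),
    family o [(o, [.call 4 (o + 1) (.const 0), reloadCmd, retCmd], lockedReg)] (fun _ => -1),
    family o [(o + 1, [callbackCmd o], fun _ => argReg), w] (fun _ => -1),
    family o [(o + 1, [.call 4 o (.const 0), retCmd], fun _ => argReg), w] (fun _ => -1),
    family o [(o, [bodyCmd o U], fun _ => argReg), x, w] (fun _ => -1),
    family o [(o, [.load 3 0, .seq (fieldCmd o U) retCmd], fun _ => argReg), x, w] (fun _ => -1),
    family o [(o, [.seq (fieldCmd o U) retCmd], fun _ => innerReg), x, w] (fun _ => -1),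
    family o [(o, [fieldCmd o U, retCmd], fun _ => innerReg), x, w] (fun _ => -1),
    family o [(o, [finishCmd, retCmd], fun _ => innerReg), x, w] (fun _ => -1),
    family o [(o, [.assign 4 (.const (-2)), .store 0 4, retCmd], fun _ => innerReg), x, w]
      (fun _ => -1),
    family o [(o, [.store 0 4, retCmd], fun _ => innerFinishReg), x, w] (fun _ => -1),
    family o [(o, [retCmd], fun _ => innerFinishReg), x, w] (fun _ => -2),
    family o [(o, [], fun _ => innerExitReg), x, w] (fun _ => -2),
    family o [(o + 1, [.assign 4 (.var resVar), retCmd], fun _ => middleReg), w] (fun _ => -2),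
    family o [(o + 1, [retCmd], fun _ => middleAssignedReg), w] (fun _ => -2),
    family o [(o + 1, [], fun _ => middleExitReg), w] (fun _ => -2),
    family o [(o, waitCmds, returnedReg)] (fun _ => -2),
    family o [(o, [reloadCmd, retCmd], assignedReg)] (fun _ => -2),
    family o [(o, [.load 4 0, checkCmd, retCmd], assignedReg)] (fun _ => -2),
    family o [(o, [checkCmd, retCmd], reloadedReg)] (fun _ => -2),
    family o [(o, [retCmd], reloadedReg)] (fun _ => -2),
    family o [(o, [], exitReg)] (fun _ => -2) ]

/-- The states of an execution with a callback to `o`. -/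
def callbackStates (o : ObjId) (U : Cmd) : List (ℕ → State) :=
  family o [] (fun n => n) :: family o [(o, [bodyCmd o U], fun _ => argReg)] (fun n => n) ::
    (activeStates o U ++ [family o [] fun _ => -2])

/-- An execution of `context o U` with a callback to `o`, during which the field of `o` changes from
`n` to `-2`. -/
def callbackExecution (o : ObjId) (U : Cmd) (n : ℕ) : Execution :=
  path ((callbackStates o U).map (· n))

theorem isChain_callbackStates (o : ObjId) (U : Cmd) (n : ℕ) :
    ((callbackStates o U).map (· n)).IsChain (Step (context o U)) := by
  have hself := context_lookup_self o U
  have hsucc := context_lookup_succ o U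
  simp only [callbackStates, activeStates, family, List.map_cons, List.map_nil, List.cons_append,
    List.nil_append, List.isChain_cons_cons, List.isChain_singleton, and_true]
  -- One rule per transition; the goals left open are values of guards and variables.
  refine ⟨.invoke _ _ _ 0 hself (mem_storeWith_self _ _), .seq .., .load_storeWith, .seq ..,
    .ifFalse _ _ _ _ _ _ _ _ ?_, .ifTrue _ _ _ _ _ _ _ _ ?_, .seq .., .assign _ _ _ _ _ _ _ _ rfl,
    .seq .., .store_storeWith ?_, .seq .., .call _ _ _ _ _ _ _ _ _ _ rfl hsucc
      (mem_storeWith_succ _ _), .seq .., .call _ _ _ _ _ _ _ _ _ _ rfl hself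
      (mem_storeWith_self _ _), .seq .., .load_storeWith, .seq .., .ifTrue _ _ _ _ _ _ _ _ ?_,
    .seq .., .assign _ _ _ _ _ _ _ _ rfl, .store_storeWith ?_, .assign _ _ _ _ _ _ _ _ rfl,
    .ret _ _ _ _ _ _ _ _ ?_, .assign _ _ _ _ _ _ _ _ ?_, .assign _ _ _ _ _ _ _ _ rfl,
    .ret _ _ _ _ _ _ _ _ ?_, .assign _ _ _ _ _ _ _ _ ?_, .seq .., .load_storeWith,
    .check _ _ _ _ _ _ ?_, .assign _ _ _ _ _ _ _ _ rfl, .exit ..⟩ <;>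
  simp [BExpr.eval, Expr.eval, outerReg, argReg, argVar, lockedReg, innerReg, innerFinishReg,
    innerExitReg, middleReg, middleExitReg, returnedReg, reloadedReg]

theorem isComplete_callbackExecution (o : ObjId) (U : Cmd) (n : ℕ) :
    IsComplete (context o U) (callbackExecution o U n) := by
  have h := isChain_callbackStates o U n
  simp only [callbackExecution, callbackStates, List.map_cons, List.map_append, List.map_nil] at h ⊢
  refine isComplete_path h rfl rfl ?_ ?_
  · simp [activeStates, family, State.Quiescent]
  · have : ∀ Θ v, FieldsDisjoint (family o Θ v n).store := fun Θ v => fieldsDisjoint_storeWith _ _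
    simp [activeStates, this]

theorem hasCallback_callbackExecution (o : ObjId) (U : Cmd) (n : ℕ) :
    HasCallback o (callbackExecution o U n) := by
  let Θ := [(o + 1, [.assign 4 (.var resVar), retCmd], fun _ => argReg), (o, waitCmds, lockedReg)]
  refine ⟨⟨family o ((o, [bodyCmd o U], fun _ => argReg) :: Θ) (fun _ => -1) n,
    family o ((o, [.load 3 0, .seq (fieldCmd o U) retCmd], fun _ => argReg) :: Θ) (fun _ => -1) n⟩,
    ?_, .inl ⟨_, _, _, .refl _, rfl, Nat.succ_ne_self o, rfl⟩⟩
  -- Fourteen transitions precede the state in which `o` has just been called back.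
  iterate 14 refine List.mem_cons_of_mem _ ?_
  exact List.mem_cons_self

theorem computable_callbackExecution (o : ObjId) (U : Cmd) :
    Computable fun n => inputCode (context o U) (callbackExecution o U n) := by
  have hn := computable_intCode_natCast
  have hc : ∀ z : ℤ, Computable fun _ : ℕ => intCode z := fun z => .const _
  have h₀ : UniformMap intCode fun _ => argReg := .singleton _ (hc 0)
  have h₁ : UniformMap intCode outerReg := h₀.insert _ hn
  have h₂ : UniformMap intCode lockedReg := h₁.insert _ (hc _)
  have h₃ : UniformMap intCode returnedReg := h₂.insert _ (hc _)
  have h₄ : UniformMap intCode assignedReg := h₃.insert _ (hc _)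
  have h₅ : UniformMap intCode reloadedReg := h₄.insert _ (hc _)
  have h₆ : UniformMap intCode exitReg := h₅.insert _ (hc _)
  have i₁ : UniformMap intCode fun _ => innerReg := h₀.insert _ (hc _)
  have i₂ : UniformMap intCode fun _ => innerFinishReg := i₁.insert _ (hc _)
  have i₃ : UniformMap intCode fun _ => innerExitReg := i₂.insert _ (hc _)
  have m₁ : UniformMap intCode fun _ => middleReg := h₀.insert _ (hc _)
  have m₂ : UniformMap intCode fun _ => middleAssignedReg := m₁.insert _ (hc _)
  have m₃ : UniformMap intCode fun _ => middleExitReg := m₂.insert _ (hc _)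
  refine computable_natPair (.const _) (computable_path _ ?_)
  simp only [callbackStates, activeStates, List.cons_append, List.nil_append, List.mem_cons,
    List.not_mem_nil, or_false, forall_eq_or_imp, forall_eq]
  refine ⟨?_, ?_, ?_, ?_, ?_, ?_, ?_, ?_, ?_, ?_, ?_, ?_, ?_, ?_, ?_, ?_, ?_, ?_, ?_, ?_, ?_, ?_, ?_,
    ?_, ?_, ?_, ?_, ?_, ?_, ?_, ?_, ?_, ?_⟩ <;> refine computable_family o ?_ ?_ <;>
  first
  | exact hn
  | exact hc _
  | simp only [List.mem_cons, List.not_mem_nil, or_false, forall_eq_or_imp, forall_eq,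
      IsEmpty.forall_iff, implies_true, *, and_self]

/-! ## Undecidability -/

/-- A single universal `U` serves all programs: the number of the program is in the field, so the
context does not vary. Variable `3` is where `bodyCmd` loads the field; smaller ones are reserved
for `argVar`, `retVar` and `resVar`. -/
theorem exists_universal_cmd : ∃ U : Cmd, U.IsPure ∧ ∀ ρ (n : ℕ), ρ.lookup 3 = some (n : ℤ) →
    ((∃ ρ', BigStep U ρ ρ') ↔ ((Denumerable.ofNat Nat.Partrec.Code n).eval 0).Dom) := by
  have hf : Partrec fun n : ℕ => (Denumerable.ofNat Nat.Partrec.Code n).eval 0 :=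
    Nat.Partrec.Code.eval_part.comp (Computable.ofNat _) (Computable.const 0)
  obtain ⟨P, hP⟩ := exists_computes (Partrec.nat_iff.1 hf)
  refine ⟨P 3, (hP 3).1, fun ρ n h => ⟨?_, ((hP 3).2 ρ n h).2⟩⟩
  rintro ⟨ρ', h'⟩
  exact (((hP 3).2 ρ n h).1 ρ' h').1

theorem decf_callbackExecution_iff (o : ObjId) {U : Cmd} (hU : U.IsPure) {n : ℕ} {D : Prop}
    (h : ∀ ρ, ρ.lookup 3 = some (n : ℤ) → ((∃ ρ', BigStep U ρ ρ') ↔ D)) :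
    DECF o (context o U) (callbackExecution o U n) ↔ D := by
  have h₁ : (firstState (callbackExecution o U n)).map (fun s => s.store.lookup o) =
    some ((storeWith o n).lookup o) := rfl
  have h₂ : (lastState (callbackExecution o U n)).map (fun s => s.store.lookup o) =
    some ((storeWith o (-2)).lookup o) := rfl
  constructor
  · intro hd
    by_contra hD
    exact not_decf_of_diverges h₁ h₂ hU (fun ρ ρ' h₃ h₄ => hD ((h ρ h₃).1 ⟨ρ', h₄⟩)) hd
  · exact fun hD => decf_of_terminates h₁ h₂ fun ρ h₃ => (h ρ h₃).2 hD

theorem DecidableOn.mono {V W P : Context → Execution → Prop} (h : DecidableOn V P)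
    (hWV : ∀ Γ ξ, W Γ ξ → V Γ ξ) : DecidableOn W P :=
  h.imp fun _ h => ⟨h.1, fun Γ ξ hW => h.2 Γ ξ (hWV Γ ξ hW)⟩

/-- A decision procedure, composed with the computable map from programs to inputs, would solve the
halting problem for input `0`. -/
theorem not_decidableOn_decf (o : ObjId) : ¬ DecidableOn
    (fun Γ ξ => IsComplete Γ ξ ∧ WellFormed ξ ∧ HasCallback o ξ) (DECF o) := by
  rintro ⟨f, hf, hdec⟩
  obtain ⟨U, hU, hU'⟩ := exists_universal_cmd
  have key : ∀ c : Nat.Partrec.Code,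
      ∃ b ∈ f (inputCode (context o U) (callbackExecution o U (Encodable.encode c))),
        (b = true ↔ (c.eval 0).Dom) := by
    intro c
    obtain ⟨b, hb, h⟩ := hdec (context o U) (callbackExecution o U (Encodable.encode c))
      ⟨isComplete_callbackExecution _ _ _, wellFormed_path _, hasCallback_callbackExecution _ _ _⟩
    refine ⟨b, hb, h.trans (decf_callbackExecution_iff o hU fun ρ hρ => ?_)⟩
    rw [hU' ρ _ hρ, Denumerable.ofNat_encode]
  choose b hb hb' using key
  refine ComputablePred.halting_problem 0 (ComputablePred.computable_iff.2 ⟨b, ?_, ?_⟩)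
  -- `f` may be partial, but it converges on all these inputs, so the composite is the total
  -- function `b`.
  · refine Partrec.of_eq (hf.comp ((computable_callbackExecution o U).comp Computable.encode)) ?_
    exact fun c => Part.eq_some_iff.2 (hb c)
  · exact funext fun c => propext (hb' c).symm

end ECF

/-- For every object `o`, no algorithm decides, given a well-formed complete execution and its code
context, whether it is final-state effectively callback-free for `o`; this remains so if only
executions that contain a callback to `o` are given. -/
theorem mainTheorem3 (o : ECF.ObjId) :
    ¬ ECF.DecidableOn (fun Γ ξ => ECF.IsComplete Γ ξ ∧ ECF.WellFormed ξ) (ECF.DECF o) ∧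
    ¬ ECF.DecidableOn
        (fun Γ ξ => ECF.IsComplete Γ ξ ∧ ECF.WellFormed ξ ∧ ECF.HasCallback o ξ) (ECF.DECF o) := by
  have h := ECF.not_decidableOn_decf o
  -- An algorithm for all complete executions would also serve for those with a callback.
  exact ⟨fun h' => h (h'.mono fun _ _ hV => ⟨hV.1, hV.2.1⟩), h⟩
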